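/- Let $M$ be a finite matroid with ground set $E(M)$, let $k$ be a field, and let $S=k[x_e : e\in E(M)]$ with its standard grading. The facet ideal $\mathcal F(M)\subset S$ is the ideal generated by the monomials $\prod_{e\in\sigma}x_e$ for $\sigma$ a basis of $M$. Let $B_1,\dots,B_t$ be the (distinct) blocks of $M$, i.e. the equivalence classes of the relation on $E(M)$ that relates $e$ and $f$ if $e=f$ or some circuit of $M$ contains both $e$ and $f$. Regard each $B_j$ as the restriction of $M$ to $B_j$, and let $S\mathcal F(B_j)$ be the ideal of $S$ generated by $\mathcal F(B_j)\subset k[x_e : e\in B_j]$. For each $1\le j\le t$, let $$F_j:\quad 0\leftarrow S(-r_j)^{n_{0,j}}\leftarrow S(-(r_j+1))^{n_{1,j}}\leftarrow\cdots\leftarrow S(-(r_j+l_j))^{n_{l_j,j}}\leftarrow 0$$ be a (linear) $\mathbb N$-graded minimal free resolution of $S\mathcal F(B_j)$: the maps preserve degrees, the image of each map $F_{j,u+1}\to F_{j,u}$ lies in $\langle x_e : e\in E(M)\rangle F_{j,u}$, and the complex is exact except at $F_{j,0}$, where the cokernel of $F_{j,1}\to F_{j,0}$ is isomorphic to $S\mathcal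 F(B_j)$ as a graded module. Put $$r=\sum_{j=1}^t r_j,\qquad l=\sum_{j=1}^t l_j,\qquad \beta_i=\sum_{u_1+\cdots+u_t=i}n_{u_1,1}n_{u_2,2}\cdots n_{u_t,t}\quad(i\ge 0),$$ where $n_{u,j}=0$ for $u>l_j$. Then the tensor product of complexes $F_1\otimes_S\cdots\otimes_S F_t$ has the form $$0\leftarrow S(-r)^{\beta_0}\leftarrow S(-(r+1))^{\beta_1}\leftarrow\cdots\leftarrow S(-(r+l))^{\beta_l}\leftarrow 0$$ and is an $\mathbb N$-graded minimal free resolution of $\mathcal F(M)$. In particular, $\mathcal F(M)$ has a linear minimal free resolution of this form. If $n_{l_j,j}\neq 0$ for all $j$, then $\beta_l\neq 0$. (For $t=0$, i.e. $E(M)=\emptyset$, the tensor product is $S$ in degree $0$.) -/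

import Mathlib

namespace MatroidFacet

open MvPolynomial

/-! ### Blocks and facet ideals of matroids -/

/-- The relation `e ξ f` on the ground set: `e = f`, or some circuit contains both. -/
def BlockRel {α : Type*} (M : Matroid α) (e f : α) : Prop :=
  e = f ∨ ∃ C, M.IsCircuit C ∧ e ∈ C ∧ f ∈ C

/-- A block (connected component) of `M` is a class of the relation `ξ` on the ground set. -/
def IsBlock {α : Type*} (M : Matroid α) (B : Set α) : Prop :=
  ∃ e ∈ M.E, B = {f ∈ M.E | BlockRel M e f}

theorem IsBlock.subset_ground {α : Type*} {M : Matroid α} {B : Set α} (h : IsBlock M B) :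
    B ⊆ M.E := by
  obtain ⟨e, -, rfl⟩ := h
  exact fun f hf => hf.1

/-- The facet ideal of a finite matroid `N`, in the polynomial ring with one variable for each
element of the ground set: it is generated by the monomials `x^σ`, `σ` a basis (a maximal
independent set) of `N`. -/
noncomputable def facetIdeal (k : Type*) [Field k] {α : Type*} (N : Matroid α) :
    Ideal (MvPolynomial N.E k) :=
  Ideal.span {f | ∃ σ : Finset N.E, N.IsBase ((fun e : N.E => (e : α)) '' (σ : Set N.E)) ∧
    f = ∏ e ∈ σ, X e}

/-- The ideal `S I` of `S = k[x_e : e ∈ Y]` generated by an ideal `I` of `k[x_e : e ∈ X]`,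
where `X ⊆ Y`. -/
noncomputable def extendIdeal {k : Type*} [Field k] {α : Type*} {A B : Set α} (h : A ⊆ B)
    (I : Ideal (MvPolynomial A k)) : Ideal (MvPolynomial B k) :=
  I.map (rename (Set.inclusion h) : MvPolynomial A k →ₐ[k] MvPolynomial B k)

/-- `S · F(B)` for a subset `B` of the ground set of `M`, where `B` also denotes the restriction
of `M` to `B`, and `S = k[x_e : e ∈ E(M)]`. -/
noncomputable def blockIdeal (k : Type*) [Field k] {α : Type*} (M : Matroid α) {B : Set α}
    (h : B ⊆ M.E) : Ideal (MvPolynomial M.E k) :=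
  extendIdeal (A := B) h (facetIdeal k (M.restrict B))

/-! ### Graded free complexes and resolutions over a polynomial ring -/

/-- A sequence `F_0 ← F_1 ← F_2 ← ⋯` of finite graded free modules with chosen homogeneous bases
over `S = k[x_s : s ∈ σ]`, the maps being given by matrices. The module `F_u = ⨁_b S(-deg b)` has
basis `gens u`, and is the module of functions `gens u → S`. -/
structure GradedFreeSeq (σ k : Type*) [Field k] where
  /-- the basis of `F_u` -/
  gens : ℕ → Type
  /-- `F_u` has finite rank -/
  fin : ∀ u, Fintype (gens u)
  /-- the degrees of the basis elements of `F_u` -/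
  deg : ∀ u, gens u → ℕ
  /-- the matrix of the map `F_{u+1} → F_u` -/
  mat : ∀ u, Matrix (gens u) (gens (u + 1)) (MvPolynomial σ k)

attribute [instance] GradedFreeSeq.fin

/-- The homogeneous elements of degree `m` of `⨁_b S(-deg b)`: every monomial in the coordinate
at `b` has degree `m - deg b`. -/
def IsHomogeneousVec {σ k : Type*} [Field k] {ι : Type} (deg : ι → ℕ) (m : ℕ)
    (v : ι → MvPolynomial σ k) : Prop :=
  ∀ b, ∀ s ∈ (v b).support, s.degree + deg b = m

namespace GradedFreeSeq

variable {σ k : Type*} [Field k]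

/-- The map `F_{u+1} → F_u`. -/
noncomputable def d (F : GradedFreeSeq σ k) (u : ℕ) :
    (F.gens (u + 1) → MvPolynomial σ k) →ₗ[MvPolynomial σ k] (F.gens u → MvPolynomial σ k) :=
  (F.mat u).mulVecLin

/-- `F` is an `ℕ`-graded minimal free resolution of the (homogeneous) ideal `I` of `S`. -/
structure IsMinimalGradedResolution (F : GradedFreeSeq σ k) (I : Ideal (MvPolynomial σ k)) :
    Prop where
  /-- the boundary maps are degree-preserving -/
  degree_preserving : ∀ u m v, IsHomogeneousVec (F.deg (u + 1)) m v →
    IsHomogeneousVec (F.deg u) m (F.d u v)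
  /-- minimality: the image of each boundary map lies in `⟨x_s : s ∈ σ⟩ F_u` -/
  minimal : ∀ u, LinearMap.range (F.d u) ≤
    Ideal.span (Set.range (X : σ → MvPolynomial σ k)) •
      (⊤ : Submodule (MvPolynomial σ k) (F.gens u → MvPolynomial σ k))
  /-- the sequence is a complex, and exact, at `F_{u+1}` -/
  exact : ∀ u, LinearMap.range (F.d (u + 1)) = LinearMap.ker (F.d u)
  /-- the cokernel of `F_1 → F_0` is isomorphic to `I` as a graded module -/
  augmentation : ∃ ε : (F.gens 0 → MvPolynomial σ k) →ₗ[MvPolynomial σ k] MvPolynomial σ k,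
    (∀ m v, IsHomogeneousVec (F.deg 0) m v → (ε v).IsHomogeneous m) ∧
    LinearMap.range ε = I ∧ LinearMap.ker ε = LinearMap.range (F.d 0)

/-- `F` has the linear shape
`0 ← S(-r)^{n_0} ← S(-(r+1))^{n_1} ← ⋯ ← S(-(r+l))^{n_l} ← 0`. -/
structure HasLinearShape (F : GradedFreeSeq σ k) (r l : ℕ) (n : ℕ → ℕ) : Prop where
  rank_eq : ∀ u, Fintype.card (F.gens u) = n u
  deg_eq : ∀ u b, F.deg u b = r + u
  rank_zero : ∀ u, l < u → n u = 0

open Classical in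
/-- The matrix entry, at `b` and `c`, of the boundary map of `⨁_u F_u`: the coefficient of the
basis element `b` in the boundary of the basis element `c`. -/
noncomputable def entry (F : GradedFreeSeq σ k) (b c : Σ u, F.gens u) : MvPolynomial σ k :=
  if h : c.1 = b.1 + 1 then F.mat b.1 b.2 (h ▸ c.2) else 0

open Classical in
/-- The tensor product `F_1 ⊗_S ⋯ ⊗_S F_t` of complexes. In homological degree `i` it is
`⨁_{u_1 + ⋯ + u_t = i} F_{1,u_1} ⊗ ⋯ ⊗ F_{t,u_t}`, whose basis consists of the tensors
`b_1 ⊗ ⋯ ⊗ b_t` of basis elements `b_j` of `F_{j,u_j}`, in degree `∑ deg b_j`. The boundary map is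
`b_1 ⊗ ⋯ ⊗ b_t ↦ ∑_j (-1)^{u_1 + ⋯ + u_{j-1}} b_1 ⊗ ⋯ ⊗ d b_j ⊗ ⋯ ⊗ b_t`. -/
noncomputable def tensor {t : ℕ} (F : Fin t → GradedFreeSeq σ k) : GradedFreeSeq σ k where
  gens i := (u : ↥(Finset.piAntidiag (Finset.univ : Finset (Fin t)) i)) ×
    (∀ j, (F j).gens (u.1 j))
  fin _ := inferInstance
  deg _ b := ∑ j, (F j).deg (b.1.1 j) (b.2 j)
  mat _ b c := ∑ j,
    if ∀ a, a ≠ j →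
        (⟨b.1.1 a, b.2 a⟩ : Σ u, (F a).gens u) = ⟨c.1.1 a, c.2 a⟩ then
      (-1) ^ (∑ a ∈ Finset.univ.filter (fun a => a < j), c.1.1 a) *
        (F j).entry ⟨b.1.1 j, b.2 j⟩ ⟨c.1.1 j, c.2 j⟩
    else 0

end GradedFreeSeq

end MatroidFacet

/-! Split the variables into disjoint sets `V` and `W`, let `R` be the polynomial ring in `W`, let
`I` be generated by monomials in `V` and `J` by monomials in `W`. Over `R`, the ring `S` is free
and `I` is a direct summand of `S`, so a free resolution `F` of `I` over `S` splits over `R`.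
Hence a cycle of `F` with coordinates in `J S` is the boundary of a chain with coordinates in
`J S`. This is the vanishing of `Tor(S / I, S / J)` in positive degrees, which makes the tensor
product of `F` with a resolution of `J` a resolution of `I J`; minimality and the grading are read
off the matrix entries. The blocks of `M` are disjoint, and its bases are the unions of one basis
from each block, so that `F(M) = ∏ j, S F(B_j)`. -/

namespace MatroidFacet

open Matrix
open scoped Kronecker

theorem mem_smul_top_pi_iff {R M ι : Type*} [CommRing R] [AddCommGroup M] [Module R M] [Finite ι]
    {J : Ideal R} {v : ι → M} :
    v ∈ J • (⊤ : Submodule R (ι → M)) ↔ ∀ i, v i ∈ J • (⊤ : Submodule R M) := by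
  classical
  cases nonempty_fintype ι
  refine ⟨fun hv i => ?_, fun hv => ?_⟩
  · exact Submodule.smul_top_le_comap_smul_top J (LinearMap.proj (φ := fun _ => M) i) hv
  · rw [← LinearMap.sum_single_apply (fun _ => M) v]
    exact sum_mem fun i _ => Submodule.smul_top_le_comap_smul_top J
      (LinearMap.single R (fun _ => M) i) (hv i)

theorem projective_pi (R M ι : Type*) [CommRing R] [AddCommGroup M] [Module R M]
    [Module.Projective R M] [Finite ι] : Module.Projective R (ι → M) := by
  classical
  cases nonempty_fintype ι
  exact .of_equiv (DirectSum.linearEquivFunOnFintype R ι fun _ => M)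

section Complexes

variable {R S X Y : Type*} [CommRing R] [CommRing S] [Algebra R S]

/-- The component of homological degree `q` of a chain, `deg x` being the homological degree of the
basis element `x`. -/
def degPart (R : Type*) [CommRing R] [Algebra R S] (deg : X → ℕ) (q : ℕ) :
    (X → S) →ₗ[R] (X → S) :=
  LinearMap.pi fun x => if deg x = q then LinearMap.proj x else 0

theorem degPart_apply (deg : X → ℕ) (q : ℕ) (v : X → S) (x : X) :
    degPart R deg q v x = if deg x = q then v x else 0 := by
  rw [degPart, LinearMap.pi_apply]
  split_ifs <;> rfl

theorem degPart_degPart (deg : X → ℕ) (q : ℕ) (v : X → S) :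
    degPart R deg q (degPart R deg q v) = degPart R deg q v := by
  ext x
  simp only [degPart_apply]
  split_ifs <;> rfl

theorem exists_sum_degPart_eq_id [Finite X] (R : Type*) {S : Type*} [CommRing R] [CommRing S]
    [Algebra R S] (deg : X → ℕ) :
    ∃ N, ∀ v : X → S, ∑ q ∈ Finset.range N, degPart R deg q v = v := by
  cases nonempty_fintype X
  refine ⟨Finset.univ.sup deg + 1, fun v => funext fun x => ?_⟩
  have hx : deg x ∈ Finset.range (Finset.univ.sup deg + 1) :=
    Finset.mem_range_succ_iff.2 (Finset.le_sup (Finset.mem_univ x))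
  simp only [Finset.sum_apply, degPart_apply, Finset.sum_ite_eq, if_pos hx]

variable [Fintype X] [Fintype Y]

/-- The chains in the kernel of the boundary `D` and of the augmentation `ε`. -/
def cycles (D : Matrix X X S) (ε : X → S) : Submodule S (X → S) where
  carrier := {v | D *ᵥ v = 0 ∧ ε ⬝ᵥ v = 0}
  add_mem' hv hw := ⟨by rw [mulVec_add, hv.1, hw.1, add_zero],
    by rw [dotProduct_add, hv.2, hw.2, add_zero]⟩
  zero_mem' := ⟨mulVec_zero D, dotProduct_zero ε⟩
  smul_mem' a v hv := ⟨by rw [mulVec_smul, hv.1, smul_zero],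
    by rw [dotProduct_smul, hv.2, smul_zero]⟩

/-- A free resolution `⋯ → F₁ → F₀` of the ideal generated by the entries of `ε`, encoded by one
square matrix: `X` is a basis of `⨁ F_u`, `deg` is the homological degree, `D` is the boundary map
of `⨁ F_u`, and `ε` is the augmentation, extended by zero outside of degree zero. -/
structure IsFreeResolution (deg : X → ℕ) (D : Matrix X X S) (ε : X → S) : Prop where
  deg_eq_succ : ∀ x y, D x y ≠ 0 → deg y = deg x + 1
  deg_eq_zero : ∀ x, ε x ≠ 0 → deg x = 0
  mul_self : D * D = 0
  vecMul_eq_zero : ε ᵥ* D = 0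
  exists_mulVec_eq : ∀ v ∈ cycles D ε, ∃ w, D *ᵥ w = v

theorem mem_cycles {D : Matrix X X S} {ε v : X → S} :
    v ∈ cycles D ε ↔ D *ᵥ v = 0 ∧ ε ⬝ᵥ v = 0 :=
  Iff.rfl

theorem isFreeResolution_iff {deg : X → ℕ} {D : Matrix X X S} {ε : X → S} :
    IsFreeResolution deg D ε ↔ (∀ x y, D x y ≠ 0 → deg y = deg x + 1) ∧
      (∀ x, ε x ≠ 0 → deg x = 0) ∧ ∀ v, v ∈ cycles D ε ↔ ∃ w, D *ᵥ w = v := by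
  classical
  refine ⟨fun h => ⟨h.deg_eq_succ, h.deg_eq_zero, fun v => ⟨h.exists_mulVec_eq v, ?_⟩⟩,
    fun ⟨hD, hε, h⟩ => ⟨hD, hε, ?_, ?_, fun v => (h v).1⟩⟩
  · rintro ⟨w, rfl⟩
    exact ⟨by rw [mulVec_mulVec, h.mul_self, zero_mulVec],
      by rw [dotProduct_mulVec, h.vecMul_eq_zero, zero_dotProduct]⟩
  · refine ext_of_mulVec_single fun x => ?_
    rw [← mulVec_mulVec, ((h _).2 ⟨_, rfl⟩).1, zero_mulVec]
  · refine dotProduct_eq_zero _ fun w => ?_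
    rw [← dotProduct_mulVec, ((h _).2 ⟨w, rfl⟩).2]

namespace IsFreeResolution

variable {deg : X → ℕ} {D : Matrix X X S} {ε : X → S}

theorem mulVec_degPart_zero (h : IsFreeResolution deg D ε) (v : X → S) :
    D *ᵥ degPart R deg 0 v = 0 := by
  refine funext fun x => Finset.sum_eq_zero fun y _ => ?_
  by_cases hD : D x y = 0
  · simp only [hD, zero_mul]
  · rw [degPart_apply, if_neg (by simp [h.deg_eq_succ x y hD]), mul_zero]

theorem mulVec_degPart_succ (h : IsFreeResolution deg D ε) (q : ℕ) (v : X → S) :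
    D *ᵥ degPart R deg (q + 1) v = degPart R deg q (D *ᵥ v) := by
  ext x
  rw [degPart_apply, ← mul_boole, mulVec, mulVec, dotProduct, dotProduct, Finset.sum_mul]
  refine Finset.sum_congr rfl fun y _ => ?_
  by_cases hD : D x y = 0
  · simp only [hD, zero_mul]
  · simp only [degPart_apply, h.deg_eq_succ x y hD, Nat.succ_inj, mul_ite, mul_one, mul_zero]

theorem dotProduct_degPart_zero (h : IsFreeResolution deg D ε) (v : X → S) :
    ε ⬝ᵥ degPart R deg 0 v = ε ⬝ᵥ v := by
  refine Finset.sum_congr rfl fun x _ => ?_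
  by_cases hε : ε x = 0
  · rw [hε, zero_mul, zero_mul]
  · rw [degPart_apply, if_pos (h.deg_eq_zero x hε)]

theorem dotProduct_degPart_succ (h : IsFreeResolution deg D ε) (q : ℕ) (v : X → S) :
    ε ⬝ᵥ degPart R deg (q + 1) v = 0 := by
  refine Finset.sum_eq_zero fun x _ => ?_
  by_cases hε : ε x = 0
  · rw [hε, zero_mul]
  · rw [degPart_apply, if_neg (by simp [h.deg_eq_zero x hε]), mul_zero]

theorem mulVec_mem_cycles (h : IsFreeResolution deg D ε) (v : X → S) : D *ᵥ v ∈ cycles D ε :=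
  ((isFreeResolution_iff.1 h).2.2 _).2 ⟨v, rfl⟩

theorem exists_mulVec_eq_dotProduct_eq_zero (h : IsFreeResolution deg D ε) {v : X → S}
    (hv : v ∈ cycles D ε) : ∃ w, D *ᵥ w = v ∧ ε ⬝ᵥ w = 0 := by
  obtain ⟨w, rfl⟩ := h.exists_mulVec_eq v hv
  refine ⟨w - degPart S deg 0 w, ?_, ?_⟩
  · rw [mulVec_sub, h.mulVec_degPart_zero, sub_zero]
  · rw [dotProduct_sub, h.dotProduct_degPart_zero, sub_self]

theorem exists_linearMap_mulVec_eq (h : IsFreeResolution deg D ε) {P : Type*} [AddCommGroup P]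
    [Module R P] [Module.Projective R P] (f : P →ₗ[R] cycles D ε) :
    ∃ g : P →ₗ[R] (X → S), ∀ p, D *ᵥ g p = f p ∧ ε ⬝ᵥ g p = 0 := by
  let K : Submodule S (X → S) := LinearMap.ker (dotProductBilin S S ε)
  let d : K →ₗ[S] cycles D ε := (D.mulVecLin ∘ₗ K.subtype).codRestrict (cycles D ε) fun v =>
    h.mulVec_mem_cycles v
  have hd : Function.Surjective d := fun v => by
    obtain ⟨w, hw, hw'⟩ := h.exists_mulVec_eq_dotProduct_eq_zero v.2
    exact ⟨⟨w, hw'⟩, Subtype.ext hw⟩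
  obtain ⟨g, hg⟩ := Module.projective_lifting_property (d.restrictScalars R) f hd
  exact ⟨(K.subtype.restrictScalars R) ∘ₗ g, fun p =>
    ⟨congrArg Subtype.val (LinearMap.congr_fun hg p), (g p).2⟩⟩

theorem exists_linearMap_degPart_zero (h : IsFreeResolution deg D ε) [Module.Projective R S]
    {ρ : S →ₗ[R] S} (hρ : LinearMap.IsProj ((Ideal.span (Set.range ε)).restrictScalars R) ρ) :
    ∃ π : (X → S) →ₗ[R] cycles D ε, ∀ v ∈ cycles D ε, (π (degPart R deg 0 v) : X → S) =
      degPart R deg 0 v := by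
  let e : (X → S) →ₗ[R] S := (dotProductBilin S S ε).restrictScalars R
  have mem_range (f : S) : f ∈ LinearMap.range e ↔ f ∈ Ideal.span (Set.range ε) := by
    simp only [Ideal.mem_span_range_iff_exists_fun, mul_comm _ (ε _)]
    rfl
  obtain ⟨s, hs⟩ := Module.projective_lifting_property e.rangeRestrict
    (ρ.codRestrict (LinearMap.range e) fun f => (mem_range _).2 (hρ.map_mem f))
    e.surjective_rangeRestrict
  have hes (v : X → S) : ε ⬝ᵥ s (ε ⬝ᵥ v) = ε ⬝ᵥ v :=
    (congrArg Subtype.val (LinearMap.congr_fun hs (ε ⬝ᵥ v))).trans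
      (hρ.map_id _ ((mem_range _).1 ⟨v, rfl⟩))
  let p : (X → S) →ₗ[R] (X → S) := degPart R deg 0 - degPart R deg 0 ∘ₗ s ∘ₗ e
  have hp (v : X → S) : p v = degPart R deg 0 v - degPart R deg 0 (s (ε ⬝ᵥ v)) := rfl
  refine ⟨p.codRestrict ((cycles D ε).restrictScalars R) fun v => ⟨?_, ?_⟩, fun v hv => ?_⟩
  · rw [hp, mulVec_sub, h.mulVec_degPart_zero, h.mulVec_degPart_zero, sub_zero]
  · rw [hp, dotProduct_sub, h.dotProduct_degPart_zero, h.dotProduct_degPart_zero, hes, sub_self]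
  · change p _ = _
    rw [hp, h.dotProduct_degPart_zero, hv.2, map_zero, map_zero, sub_zero, degPart_degPart]

theorem exists_linearMap_degPart_succ (h : IsFreeResolution deg D ε) [Module.Projective R S]
    {q : ℕ} {π : (X → S) →ₗ[R] cycles D ε}
    (hπ : ∀ v ∈ cycles D ε, (π (degPart R deg q v) : X → S) = degPart R deg q v) :
    ∃ π' : (X → S) →ₗ[R] cycles D ε, ∀ v ∈ cycles D ε, (π' (degPart R deg (q + 1) v) : X → S) =
      degPart R deg (q + 1) v := by
  have := projective_pi R S X
  obtain ⟨g, hg⟩ := h.exists_linearMap_mulVec_eq π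
  let p : (X → S) →ₗ[R] (X → S) :=
    degPart R deg (q + 1) - g ∘ₗ D.mulVecLin.restrictScalars R ∘ₗ degPart R deg (q + 1)
  have hp (v : X → S) : p v = degPart R deg (q + 1) v - g (degPart R deg q (D *ᵥ v)) := by
    rw [← h.mulVec_degPart_succ]
    rfl
  refine ⟨p.codRestrict ((cycles D ε).restrictScalars R) fun v => ⟨?_, ?_⟩, fun v hv => ?_⟩
  · rw [hp, mulVec_sub, (hg _).1, hπ _ (h.mulVec_mem_cycles v), h.mulVec_degPart_succ, sub_self]
  · rw [hp, dotProduct_sub, (hg _).2, h.dotProduct_degPart_succ, sub_zero]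
  · change p _ = _
    rw [hp, h.mulVec_degPart_succ, hv.1, map_zero, map_zero, map_zero, sub_zero, degPart_degPart]

theorem exists_linearMap_cycles_eq_id (h : IsFreeResolution deg D ε) [Module.Projective R S]
    {ρ : S →ₗ[R] S} (hρ : LinearMap.IsProj ((Ideal.span (Set.range ε)).restrictScalars R) ρ) :
    ∃ π : (X → S) →ₗ[R] cycles D ε, ∀ v ∈ cycles D ε, (π v : X → S) = v := by
  have hdeg (q : ℕ) : ∃ π : (X → S) →ₗ[R] cycles D ε, ∀ v ∈ cycles D ε,
      (π (degPart R deg q v) : X → S) = degPart R deg q v := by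
    induction q with
    | zero => exact h.exists_linearMap_degPart_zero hρ
    | succ q ih => exact ih.elim fun π hπ => h.exists_linearMap_degPart_succ hπ
  choose π hπ using hdeg
  obtain ⟨N, hN⟩ := exists_sum_degPart_eq_id (S := S) R deg
  refine ⟨∑ q ∈ Finset.range N, π q ∘ₗ degPart R deg q, fun v hv => ?_⟩
  rw [LinearMap.sum_apply, AddSubmonoidClass.coe_finsetSum]
  exact (Finset.sum_congr rfl fun q _ => hπ q v hv).trans (hN v)

-- The inclusion of the boundaries splits over `R`, so it stays injective modulo `J`.
theorem exists_mulVec_eq_of_forall_mem_map (h : IsFreeResolution deg D ε) [Module.Projective R S]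
    {ρ : S →ₗ[R] S} (hρ : LinearMap.IsProj ((Ideal.span (Set.range ε)).restrictScalars R) ρ)
    {J : Ideal R} {v : X → S} (hv : v ∈ cycles D ε) (hJ : ∀ x, v x ∈ J.map (algebraMap R S)) :
    ∃ w, D *ᵥ w = v ∧ ∀ x, w x ∈ J.map (algebraMap R S) := by
  obtain ⟨π, hπ⟩ := h.exists_linearMap_cycles_eq_id hρ
  have := projective_pi R S X
  obtain ⟨g, hg⟩ := h.exists_linearMap_mulVec_eq π
  have mem_iff (u : X → S) :
      u ∈ J • (⊤ : Submodule R (X → S)) ↔ ∀ x, u x ∈ J.map (algebraMap R S) := by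
    rw [mem_smul_top_pi_iff, Ideal.smul_top_eq_map]
    rfl
  refine ⟨g v, (hg v).1.trans (hπ v hv), (mem_iff _).1 ?_⟩
  exact Submodule.smul_top_le_comap_smul_top J g ((mem_iff v).2 hJ)

theorem submatrix (h : IsFreeResolution deg D ε) (e : Y ≃ X) :
    IsFreeResolution (deg ∘ e) (D.submatrix e e) (ε ∘ e) where
  deg_eq_succ x y := h.deg_eq_succ (e x) (e y)
  deg_eq_zero x := h.deg_eq_zero (e x)
  mul_self := by rw [submatrix_mul_equiv, h.mul_self, submatrix_zero]; rfl
  vecMul_eq_zero := by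
    rw [submatrix_vecMul_equiv, Function.comp_assoc, e.self_comp_symm, Function.comp_id,
      h.vecMul_eq_zero]
    rfl
  exists_mulVec_eq v hv := by
    have hv' : v ∘ e.symm ∈ cycles D ε :=
      ⟨e.surjective.injective_comp_right ((submatrix_mulVec_equiv D v e e).symm.trans hv.1),
        (dotProduct_comp_equiv_symm ε v e).trans hv.2⟩
    obtain ⟨w, hw⟩ := h.exists_mulVec_eq _ hv'
    refine ⟨w ∘ e, ?_⟩
    rw [submatrix_mulVec_equiv, Function.comp_assoc, e.self_comp_symm, Function.comp_id, hw,
      Function.comp_assoc, e.symm_comp_self, Function.comp_id]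

end IsFreeResolution

section Tensor

theorem vec_vecMulVec_dotProduct_vec (η : Y → S) (ε : X → S) (W : Matrix Y X S) :
    vec (vecMulVec η ε) ⬝ᵥ vec W = ε ⬝ᵥ (η ᵥ* W) := by
  rw [vec_dotProduct_vec, transpose_vecMulVec, vecMulVec_mul, trace_vecMulVec]

theorem IsFreeResolution.mul_transpose_apply_eq_zero {deg : X → ℕ} {D : Matrix X X S} {ε : X → S}
    (h : IsFreeResolution deg D ε) {Z : Type*} {W : Matrix Z X S} {N : ℕ}
    (hW : ∀ x, N < deg x → ∀ z, W z x = 0) {x : X} (hx : N ≤ deg x) (z : Z) :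
    (W * Dᵀ) z x = 0 := by
  refine Finset.sum_eq_zero fun y _ => ?_
  by_cases hD : D x y = 0
  · simp only [transpose_apply, hD, mul_zero]
  · simp only [hW y (by have := h.deg_eq_succ x y hD; omega), zero_mul]

variable [DecidableEq X]

/-- The Koszul sign `(-1) ^ deg` on chains. -/
def signMat (S : Type*) [CommRing S] (deg : X → ℕ) : Matrix X X S :=
  diagonal fun x => (-1) ^ deg x

theorem signMat_mul_self (deg : X → ℕ) : signMat S deg * signMat S deg = 1 := by
  rw [signMat, diagonal_mul_diagonal, ← diagonal_one]
  simp only [← mul_pow, neg_mul_neg, one_mul, one_pow]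

theorem IsFreeResolution.mul_signMat {deg : X → ℕ} {D : Matrix X X S} {ε : X → S}
    (h : IsFreeResolution deg D ε) : D * signMat S deg = -(signMat S deg * D) := by
  ext x y
  rw [signMat, mul_diagonal, neg_apply, diagonal_mul]
  by_cases hD : D x y = 0
  · rw [hD, zero_mul, mul_zero, neg_zero]
  · rw [h.deg_eq_succ x y hD, pow_succ]
    ring

variable [DecidableEq Y]

/-- The boundary `D ⊗ 1 + (-1) ^ deg ⊗ E` of the tensor product of two complexes. A chain of the
tensor product is written as `vec W` with `W : Matrix Y X S`. -/
def tensorMat (deg : X → ℕ) (D : Matrix X X S) (E : Matrix Y Y S) : Matrix (X × Y) (X × Y) S :=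
  D ⊗ₖ 1 + signMat S deg ⊗ₖ E

variable {deg : X → ℕ} {deg' : Y → ℕ} {D : Matrix X X S} {E : Matrix Y Y S} {ε : X → S} {η : Y → S}

theorem tensorMat_mulVec_vec (deg : X → ℕ) (D : Matrix X X S) (E : Matrix Y Y S)
    (W : Matrix Y X S) :
    tensorMat deg D E *ᵥ vec W = vec (W * Dᵀ + E * W * signMat S deg) := by
  rw [tensorMat, add_mulVec, kronecker_mulVec_vec, kronecker_mulVec_vec, vec_add, Matrix.one_mul,
    signMat, diagonal_transpose]

namespace IsFreeResolution

theorem tensorMat_mul_self (h : IsFreeResolution deg D ε) (h' : IsFreeResolution deg' E η) :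
    tensorMat deg D E * tensorMat deg D E = 0 := by
  rw [tensorMat, add_mul, mul_add, mul_add, ← mul_kronecker_mul, ← mul_kronecker_mul,
    ← mul_kronecker_mul, ← mul_kronecker_mul, h.mul_self, h'.mul_self, h.mul_signMat,
    Matrix.one_mul, Matrix.one_mul, Matrix.mul_one, zero_kronecker, kronecker_zero, zero_add,
    add_zero, ← add_kronecker, neg_add_cancel, zero_kronecker]

theorem vecMul_eq_mulVec_vecMul (h' : IsFreeResolution deg' E η) {U W : Matrix Y X S}
    (hU : tensorMat deg D E *ᵥ vec U = vec W) : η ᵥ* W = D *ᵥ (η ᵥ* U) := by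
  rw [tensorMat_mulVec_vec, vec_inj] at hU
  rw [← hU, vecMul_add, ← vecMul_vecMul, vecMul_transpose, Matrix.mul_assoc, ← vecMul_vecMul,
    h'.vecMul_eq_zero, zero_vecMul, add_zero]

theorem vecMul_tensorMat (h : IsFreeResolution deg D ε) (h' : IsFreeResolution deg' E η) :
    vec (vecMulVec η ε) ᵥ* tensorMat deg D E = 0 := by
  have hD : vecMulVec η ε * D = 0 := by
    rw [vecMulVec_mul, h.vecMul_eq_zero]
    exact ext fun y _ => mul_zero (η y)
  have hE : Eᵀ * vecMulVec η ε = 0 := by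
    rw [mul_vecMulVec, mulVec_transpose, h'.vecMul_eq_zero]
    exact zero_vecMulVec ε
  rw [tensorMat, vecMul_add, vec_vecMul_kronecker, vec_vecMul_kronecker, Matrix.mul_assoc, hD, hE,
    Matrix.mul_zero, Matrix.zero_mul, vec_zero, add_zero]

theorem exists_eq_on_top_degree (h : IsFreeResolution deg D ε) (h' : IsFreeResolution deg' E η)
    {N : ℕ} {W : Matrix Y X S} (hW : ∀ x, N < deg x → ∀ y, W y x = 0)
    (hDW : tensorMat deg D E *ᵥ vec W = 0) (hη : η ᵥ* W = 0) :
    ∃ U : Matrix Y X S, η ᵥ* U = 0 ∧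
      ∀ x, N ≤ deg x → ∀ y, (U * Dᵀ + E * U * signMat S deg) y x = W y x := by
  have hcol (x : X) (hx : N ≤ deg x) : W.col x ∈ cycles E η := by
    refine ⟨funext fun y => ?_, congrFun hη x⟩
    rw [tensorMat_mulVec_vec, vec_eq_zero_iff] at hDW
    have hy := congrFun₂ hDW y x
    rw [Matrix.add_apply, h.mul_transpose_apply_eq_zero hW hx, signMat, mul_diagonal,
      zero_add] at hy
    exact ((isUnit_one.neg.pow _).mul_left_eq_zero).1 hy
  choose! u hu hηu using fun x hx => h'.exists_mulVec_eq_dotProduct_eq_zero (hcol x hx)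
  let V : Matrix Y X S := of fun y x => if deg x = N then u x y else 0
  have hV (x : X) (hx : deg x ≠ N) (y : Y) : V y x = 0 := if_neg hx
  have hVu (x : X) (hx : deg x = N) : V.col x = u x := funext fun y => if_pos hx
  have hηV : η ᵥ* V = 0 := by
    ext x
    by_cases hx : deg x = N
    · exact (congrArg (η ⬝ᵥ ·) (hVu x hx)).trans (hηu x hx.ge)
    · exact (congrArg (η ⬝ᵥ ·) (funext (hV x hx))).trans (dotProduct_zero η)
  have hEV (x : X) (hx : N ≤ deg x) (y : Y) : (E * V) y x = W y x := by
    rcases hx.eq_or_lt with hx' | hx'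
    · exact congrFun ((congrArg (E *ᵥ ·) (hVu x hx'.symm)).trans (hu x hx)) y
    · rw [hW x hx' y]
      exact congrFun ((congrArg (E *ᵥ ·) (funext (hV x hx'.ne'))).trans (mulVec_zero E)) y
  refine ⟨V * signMat S deg, by rw [← vecMul_vecMul, hηV, zero_vecMul], fun x hx y => ?_⟩
  rw [Matrix.add_apply, ← Matrix.mul_assoc E, Matrix.mul_assoc (E * V), signMat_mul_self,
    Matrix.mul_one, hEV x hx y, h.mul_transpose_apply_eq_zero (N := N) _ hx, zero_add]
  intro z hz w
  rw [signMat, mul_diagonal, hV z hz.ne', zero_mul]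

theorem exists_tensorMat_mulVec_eq_of_vecMul_eq_zero (h : IsFreeResolution deg D ε)
    (h' : IsFreeResolution deg' E η) {W : Matrix Y X S}
    (hDW : tensorMat deg D E *ᵥ vec W = 0) (hη : η ᵥ* W = 0) :
    ∃ U : Matrix Y X S, tensorMat deg D E *ᵥ vec U = vec W := by
  suffices key : ∀ N, ∀ W : Matrix Y X S, (∀ x, N ≤ deg x → ∀ y, W y x = 0) →
      tensorMat deg D E *ᵥ vec W = 0 → η ᵥ* W = 0 →
      ∃ U : Matrix Y X S, tensorMat deg D E *ᵥ vec U = vec W from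
    key (Finset.univ.sup deg + 1) W (fun x hx =>
      absurd (Finset.le_sup (f := deg) (Finset.mem_univ x)) (by omega)) hDW hη
  clear hDW hη W
  intro N
  induction N with
  | zero =>
    intro W hW _ _
    obtain rfl : W = 0 := ext fun y x => hW x (deg x).zero_le y
    exact ⟨0, by rw [vec_zero, mulVec_zero]⟩
  | succ N ih =>
    intro W hW hDW hη
    obtain ⟨U, hηU, hU⟩ := h.exists_eq_on_top_degree h' hW hDW hη
    set V := U * Dᵀ + E * U * signMat S deg
    have hUV : tensorMat deg D E *ᵥ vec U = vec V := tensorMat_mulVec_vec deg D E U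
    obtain ⟨U', hU'⟩ := ih (W - V) (fun x hx y => sub_eq_zero.2 (hU x hx y).symm)
      (by rw [vec_sub, mulVec_sub, hDW, ← hUV, mulVec_mulVec, h.tensorMat_mul_self h', zero_mulVec,
        sub_zero])
      (by rw [vecMul_sub, hη, h'.vecMul_eq_mulVec_vecMul hUV, hηU, mulVec_zero, sub_zero])
    exact ⟨U + U', by rw [vec_add, mulVec_add, hUV, hU', ← vec_add, add_sub_cancel]⟩

theorem tensor (h : IsFreeResolution deg D ε) (h' : IsFreeResolution deg' E η)
    (hJ : ∀ v ∈ cycles D ε, (∀ x, v x ∈ Ideal.span (Set.range η)) →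
      ∃ w, D *ᵥ w = v ∧ ∀ x, w x ∈ Ideal.span (Set.range η)) :
    IsFreeResolution (fun p : X × Y => deg p.1 + deg' p.2) (tensorMat deg D E)
      (vec (vecMulVec η ε)) where
  deg_eq_succ p q hpq := by
    have hpq' : D p.1 q.1 * (1 : Matrix Y Y S) p.2 q.2 ≠ 0 ∨
        signMat S deg p.1 q.1 * E p.2 q.2 ≠ 0 := by
      by_contra! h0
      exact hpq ((congrArg₂ (· + ·) h0.1 h0.2).trans (add_zero 0))
    rcases hpq' with hD | hE
    · have hy : p.2 = q.2 := by_contra fun hy => right_ne_zero_of_mul hD (one_apply_ne hy)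
      rw [h.deg_eq_succ _ _ (left_ne_zero_of_mul hD), hy, add_right_comm]
    · have hx : p.1 = q.1 := by_contra fun hx => left_ne_zero_of_mul hE (diagonal_apply_ne _ hx)
      rw [h'.deg_eq_succ _ _ (right_ne_zero_of_mul hE), hx, add_assoc]
  deg_eq_zero p hp := by
    rw [h.deg_eq_zero p.1 (right_ne_zero_of_mul hp), h'.deg_eq_zero p.2 (left_ne_zero_of_mul hp)]
  mul_self := h.tensorMat_mul_self h'
  vecMul_eq_zero := h.vecMul_tensorMat h'
  exists_mulVec_eq v := by
    obtain ⟨W, rfl⟩ := vec_bijective.surjective v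
    rintro ⟨hDW, hεW⟩
    rw [vec_vecMulVec_dotProduct_vec] at hεW
    have hηW : η ᵥ* W ∈ cycles D ε :=
      ⟨by rw [← h'.vecMul_eq_mulVec_vecMul (hDW.trans vec_zero.symm), vecMul_zero], hεW⟩
    have mem_span_iff (v : X → S) : (∀ x, v x ∈ Ideal.span (Set.range η)) ↔
        ∃ U : Matrix Y X S, η ᵥ* U = v := by
      simp only [Ideal.mem_span_range_iff_exists_fun, Classical.skolem, mul_comm _ (η _)]
      exact ⟨fun ⟨U, hU⟩ => ⟨of fun y x => U x y, funext hU⟩,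
        fun ⟨U, hU⟩ => ⟨fun x y => U y x, congrFun hU⟩⟩
    obtain ⟨w, hw, hwη⟩ := hJ _ hηW ((mem_span_iff _).2 ⟨W, rfl⟩)
    obtain ⟨U, rfl⟩ := (mem_span_iff w).1 hwη
    obtain ⟨V, hV⟩ := vec_bijective.surjective (tensorMat deg D E *ᵥ vec U)
    obtain ⟨U', hU'⟩ := h.exists_tensorMat_mulVec_eq_of_vecMul_eq_zero h' (W := W - V)
      (by rw [vec_sub, mulVec_sub, hDW, hV, mulVec_mulVec, h.tensorMat_mul_self h', zero_mulVec,
        sub_zero])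
      (by rw [vecMul_sub, h'.vecMul_eq_mulVec_vecMul hV.symm, hw, sub_self])
    exact ⟨vec U + vec U', by rw [mulVec_add, hU', ← hV, ← vec_add, add_sub_cancel]⟩

end IsFreeResolution
end Tensor

end Complexes

open MvPolynomial

section MonomialIdeals

variable {σ k : Type*} [CommRing k] {V W : Set σ} {I J : Ideal (MvPolynomial σ k)}

/-- The ideal `I` is generated by monomials in the variables `x_s`, `s ∈ V`. -/
def IsMonomialIdealIn (V : Set σ) (I : Ideal (MvPolynomial σ k)) : Prop :=
  ∃ T : Set (σ →₀ ℕ), (∀ m ∈ T, ↑m.support ⊆ V) ∧ I = Ideal.span ((monomial · 1) '' T)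

theorem IsMonomialIdealIn.mono (hI : IsMonomialIdealIn V I) (hVW : V ⊆ W) :
    IsMonomialIdealIn W I :=
  hI.imp fun _ hT => ⟨fun m hm => (hT.1 m hm).trans hVW, hT.2⟩

theorem IsMonomialIdealIn.top : IsMonomialIdealIn V (⊤ : Ideal (MvPolynomial σ k)) :=
  ⟨{0}, by simp, by simp⟩

open scoped Pointwise in
theorem IsMonomialIdealIn.mul (hI : IsMonomialIdealIn V I) (hJ : IsMonomialIdealIn W J) :
    IsMonomialIdealIn (V ∪ W) (I * J) := by
  classical
  obtain ⟨T, hT, rfl⟩ := hI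
  obtain ⟨T', hT', rfl⟩ := hJ
  refine ⟨T + T', ?_, ?_⟩
  · rintro _ ⟨m, hm, m', hm', rfl⟩
    refine (Finset.coe_subset.2 Finsupp.support_add).trans ?_
    rw [Finset.coe_union]
    exact Set.union_subset_union (hT m hm) (hT' m' hm')
  · rw [Ideal.span_mul_span', ← Set.image2_mul, ← Set.image2_add, Set.image_image2,
      Set.image2_image_left, Set.image2_image_right]
    simp only [monomial_mul, one_mul]

theorem IsMonomialIdealIn.prod {ι : Type*} {s : Finset ι} {V : ι → Set σ}
    {I : ι → Ideal (MvPolynomial σ k)} (hI : ∀ j ∈ s, IsMonomialIdealIn (V j) (I j)) :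
    IsMonomialIdealIn (⋃ j ∈ s, V j) (∏ j ∈ s, I j) := by
  classical
  induction s using Finset.induction_on with
  | empty =>
    rw [Finset.prod_empty, Ideal.one_eq_top]
    exact .top
  | insert a s ha ih =>
    rw [Finset.prod_insert ha, Finset.set_biUnion_insert]
    exact (hI a (s.mem_insert_self a)).mul (ih fun j hj => hI j (Finset.mem_insert_of_mem hj))

open Classical in
/-- The sum of the terms of a polynomial whose exponents lie in `U`. -/
noncomputable def termsIn (U : Set (σ →₀ ℕ)) : MvPolynomial σ k →ₗ[k] MvPolynomial σ k :=
  (basisMonomials σ k).constr k fun m => if m ∈ U then monomial m 1 else 0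

open Classical in
theorem termsIn_monomial (U : Set (σ →₀ ℕ)) (m : σ →₀ ℕ) (a : k) :
    termsIn U (monomial m a) = if m ∈ U then monomial m a else 0 := by
  have hm : monomial m a = a • basisMonomials σ k m := by
    rw [coe_basisMonomials, smul_monomial, smul_eq_mul, mul_one]
  rw [hm, map_smul, termsIn, Module.Basis.constr_basis, coe_basisMonomials, smul_ite, smul_zero]

open Classical in
theorem coeff_termsIn (U : Set (σ →₀ ℕ)) (f : MvPolynomial σ k) (m : σ →₀ ℕ) :
    coeff m (termsIn U f) = if m ∈ U then coeff m f else 0 := by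
  induction f using MvPolynomial.induction_on' with
  | monomial u a =>
    rw [termsIn_monomial]
    by_cases hu : u = m
    · rw [hu, apply_ite (coeff m), coeff_zero]
    · rw [apply_ite (coeff m), coeff_monomial, if_neg hu, coeff_zero, ite_self, ite_self]
  | add p q hp hq =>
    rw [map_add, coeff_add, hp, hq, coeff_add]
    exact (ite_add_zero ..).symm

theorem termsIn_monomial_mul {U : Set (σ →₀ ℕ)} {b : σ →₀ ℕ} (hb : ∀ m, b + m ∈ U ↔ m ∈ U)
    (a : k) (f : MvPolynomial σ k) :
    termsIn U (monomial b a * f) = monomial b a * termsIn U f := by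
  classical
  induction f using MvPolynomial.induction_on' with
  | monomial u c =>
    rw [monomial_mul, termsIn_monomial, termsIn_monomial, mul_ite, mul_zero, monomial_mul]
    exact if_congr (hb u) rfl rfl
  | add p q hp hq => rw [mul_add, map_add, hp, hq, map_add, mul_add]

theorem le_add_iff_of_disjoint_support {t b m : σ →₀ ℕ} (h : Disjoint t.support b.support) :
    t ≤ b + m ↔ t ≤ m := by
  refine ⟨fun hle s => ?_, fun hle => hle.trans le_add_self⟩
  by_cases hs : s ∈ t.support
  · have hb : b s = 0 := Finsupp.notMem_support_iff.1 (Finset.disjoint_left.1 h hs)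
    exact (hle s).trans_eq (by rw [Finsupp.add_apply, hb, zero_add])
  · rw [Finsupp.notMem_support_iff.1 hs]
    exact zero_le

theorem termsIn_upperClosure_mul {T : Set (σ →₀ ℕ)} (hT : ∀ m ∈ T, ↑m.support ⊆ V)
    {p : MvPolynomial σ k} (hp : p ∈ supported k Vᶜ) (f : MvPolynomial σ k) :
    termsIn (upperClosure T : Set (σ →₀ ℕ)) (p * f) = p * termsIn (upperClosure T) f := by
  rw [p.as_sum, Finset.sum_mul, map_sum, Finset.sum_mul]
  refine Finset.sum_congr rfl fun b hb => termsIn_monomial_mul (fun m => ?_) _ f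
  refine exists_congr fun t => and_congr_right fun ht => le_add_iff_of_disjoint_support ?_
  have hbV : (b.support : Set σ) ⊆ Vᶜ := fun s hs =>
    mem_supported.1 hp ((mem_vars_iff_mem_support s).2 ⟨b, hb, hs⟩)
  exact Finset.disjoint_coe.1 (disjoint_compl_right.mono (hT t ht) hbV)

theorem IsMonomialIdealIn.exists_isProj (hI : IsMonomialIdealIn V I) :
    ∃ ρ : MvPolynomial σ k →ₗ[supported k Vᶜ] MvPolynomial σ k,
      LinearMap.IsProj (I.restrictScalars (supported k Vᶜ)) ρ := by
  classical
  obtain ⟨T, hT, rfl⟩ := hI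
  refine ⟨{ termsIn (upperClosure T : Set (σ →₀ ℕ)) with
    map_smul' := fun p f => termsIn_upperClosure_mul hT p.2 f }, fun f => ?_, fun f hf => ?_⟩
  · refine mem_ideal_span_monomial_image.2 fun m hm => ?_
    by_contra hmT
    exact mem_support_iff.1 hm ((coeff_termsIn _ f m).trans (if_neg hmT))
  · ext m
    refine (coeff_termsIn _ f m).trans (ite_eq_left_iff.2 fun hmT => ?_)
    by_contra hm
    exact hmT (mem_ideal_span_monomial_image.1 hf m (mem_support_iff.2 (Ne.symm hm)))

theorem IsMonomialIdealIn.exists_eq_map (hI : IsMonomialIdealIn V I) :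
    ∃ I' : Ideal (supported k V), I = I'.map (algebraMap (supported k V) (MvPolynomial σ k)) := by
  obtain ⟨T, hT, rfl⟩ := hI
  have monomial_mem (m : σ →₀ ℕ) (hm : m ∈ T) : monomial m (1 : k) ∈ supported k V := by
    rw [mem_supported]
    intro s hs
    obtain ⟨b, hb, hsb⟩ := (mem_vars_iff_mem_support s).1 hs
    obtain rfl := Finset.mem_singleton.1 (support_monomial_subset hb)
    exact hT b hm hsb
  refine ⟨Ideal.span (algebraMap (supported k V) (MvPolynomial σ k) ⁻¹' ((monomial · 1) '' T)), ?_⟩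
  rw [Ideal.map_span, Set.image_preimage_eq_iff.2]
  rintro _ ⟨m, hm, rfl⟩
  exact ⟨⟨_, monomial_mem m hm⟩, rfl⟩

theorem free_over_supported_compl (V : Set σ) :
    Module.Free (supported k Vᶜ) (MvPolynomial σ k) := by
  classical
  let e := supportedEquivMvPolynomial (R := k) Vᶜ
  let E : MvPolynomial σ k ≃ₐ[k] MvPolynomial V (MvPolynomial (Vᶜ : Set σ) k) :=
    (renameEquiv k (Equiv.Set.sumCompl V).symm).trans (sumAlgEquiv k V (Vᶜ : Set σ))
  have E_symm : (E.toAlgHom.comp (supported k Vᶜ).val).comp e.symm.toAlgHom =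
      IsScalarTower.toAlgHom k _ _ := by
    ext i
    simp [e, E, MvPolynomial.algebraMap_eq, Equiv.Set.sumCompl_symm_apply_compl]
  have E_apply (p : supported k Vᶜ) : E p = C (e p) := by
    simpa using AlgHom.congr_fun E_symm (e p)
  have := RingHomInvPair.of_ringEquiv e.toRingEquiv
  have := RingHomInvPair.of_ringEquiv_symm e.toRingEquiv
  let E' : MvPolynomial σ k ≃ₛₗ[RingHomClass.toRingHom e.toRingEquiv]
      MvPolynomial V (MvPolynomial (Vᶜ : Set σ) k) :=
    { E with
      map_smul' := fun p f => by
        change E (p • f) = e p • E f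
        rw [smul_eq_C_mul, ← E_apply, ← map_mul]
        rfl }
  exact .of_equiv E'.symm

theorem IsFreeResolution.tensor_of_disjoint {X Y : Type*} [Fintype X] [Fintype Y] [DecidableEq X]
    [DecidableEq Y] {deg : X → ℕ} {D : Matrix X X (MvPolynomial σ k)} {ε : X → MvPolynomial σ k}
    {deg' : Y → ℕ} {E : Matrix Y Y (MvPolynomial σ k)} {η : Y → MvPolynomial σ k}
    (h : IsFreeResolution deg D ε) (h' : IsFreeResolution deg' E η) (hVW : Disjoint V W)
    (hε : IsMonomialIdealIn V (Ideal.span (Set.range ε)))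
    (hη : IsMonomialIdealIn W (Ideal.span (Set.range η))) :
    IsFreeResolution (fun p : X × Y => deg p.1 + deg' p.2) (tensorMat deg D E)
      (vec (vecMulVec η ε)) := by
  obtain ⟨ρ, hρ⟩ := hε.exists_isProj
  obtain ⟨J, hJ⟩ := (hη.mono hVW.subset_compl_left).exists_eq_map
  have := free_over_supported_compl (k := k) V
  refine h.tensor h' fun v hv hvη => ?_
  rw [hJ] at hvη ⊢
  exact h.exists_mulVec_eq_of_forall_mem_map hρ hv hvη

end MonomialIdeals

section Blocks

variable {α : Type*} {M : Matroid α}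

theorem exists_isCircuit_of_subset_insert {e g : α} {I C₁ C₂ : Set α} (hI : M.Indep I)
    (h₁ : M.IsCircuit C₁) (h₂ : M.IsCircuit C₂) (hC₁ : C₁ ⊆ insert e I) (hC₂ : C₂ ⊆ insert g I)
    (he : e ∈ C₁) (hg : g ∈ C₂) (h : (C₁ ∩ C₂).Nonempty) :
    ∃ C, M.IsCircuit C ∧ e ∈ C ∧ g ∈ C := by
  by_cases he₂ : e ∈ C₂
  · exact ⟨C₂, h₂, he₂, hg⟩
  obtain ⟨f, hf₁, hf₂⟩ := h
  obtain ⟨C, hCsub, hC, heC⟩ := h₁.strong_elimination h₂ hf₁ hf₂ he he₂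
  refine ⟨C, hC, heC, by_contra fun hgC => ?_⟩
  have hCI : C ⊆ insert e I := fun x hx => (hCsub hx).1.elim (fun hx₁ => hC₁ hx₁) fun hx₂ =>
    .inr ((hC₂ hx₂).resolve_left (ne_of_mem_of_not_mem hx hgC))
  rw [h₁.eq_fundCircuit_of_subset hI hC₁, ← hC.eq_fundCircuit_of_subset hI hCI] at hf₁
  exact (hCsub hf₁).2 rfl

theorem exists_isCircuit_of_inter_nonempty {e g : α} {C₁ C₂ : Set α} (h₁ : M.IsCircuit C₁)
    (h₂ : M.IsCircuit C₂) (he : e ∈ C₁) (hg : g ∈ C₂) (h : (C₁ ∩ C₂).Nonempty) :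
    ∃ C, M.IsCircuit C ∧ e ∈ C ∧ g ∈ C := by
  by_cases hg₁ : g ∈ C₁
  · exact ⟨C₁, h₁, he, hg₁⟩
  obtain ⟨I, hI, hC₁I⟩ := (h₁.sdiff_singleton_indep he).subset_isBasis_of_subset
    (X := (C₁ ∪ C₂) \ {g})
    (fun x hx => ⟨.inl hx.1, ne_of_mem_of_not_mem hx.1 hg₁⟩)
    (Set.sdiff_subset.trans (Set.union_subset h₁.subset_ground h₂.subset_ground))
  have hg_closure : g ∈ M.closure I := by
    rw [hI.closure_eq_closure]
    exact M.closure_subset_closure (Set.sdiff_subset_sdiff_left Set.subset_union_right)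
      (h₂.mem_closure_sdiff_singleton_of_mem hg)
  have hC : M.IsCircuit (M.fundCircuit g I) :=
    hI.indep.fundCircuit_isCircuit hg_closure fun hgI => (hI.subset hgI).2 rfl
  refine exists_isCircuit_of_subset_insert hI.indep h₁ hC (Set.sdiff_singleton_subset_iff.1 hC₁I)
    (M.fundCircuit_subset_insert g I) he (M.mem_fundCircuit g I) ?_
  by_contra! hempty
  have hC₂ : M.fundCircuit g I ⊆ C₂ := fun x hx => by
    rcases M.fundCircuit_subset_insert g I hx with rfl | hxI
    · exact hg
    · exact (hI.subset hxI).1.resolve_left fun hx₁ => hempty.le ⟨hx₁, hx⟩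
  exact h.ne_empty (hC.eq_of_subset_isCircuit h₂ hC₂ ▸ hempty)

theorem BlockRel.symm {e f : α} (h : BlockRel M e f) : BlockRel M f e :=
  h.imp Eq.symm fun ⟨C, hC, he, hf⟩ => ⟨C, hC, hf, he⟩

theorem BlockRel.trans {e f g : α} (h : BlockRel M e f) (h' : BlockRel M f g) :
    BlockRel M e g := by
  rcases h with rfl | ⟨C, hC, he, hf⟩
  · exact h'
  rcases h' with rfl | ⟨C', hC', hf', hg⟩
  · exact .inr ⟨C, hC, he, hf⟩
  · exact .inr (exists_isCircuit_of_inter_nonempty hC hC' he hg ⟨f, hf, hf'⟩)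

theorem IsBlock.eq_of_mem {A B : Set α} (hA : IsBlock M A) (hB : IsBlock M B) {e : α}
    (heA : e ∈ A) (heB : e ∈ B) : A = B := by
  obtain ⟨a, -, rfl⟩ := hA
  obtain ⟨b, -, rfl⟩ := hB
  ext f
  exact and_congr_right fun _ =>
    ⟨fun h => (heB.2.trans heA.2.symm).trans h, fun h => (heA.2.trans heB.2.symm).trans h⟩

theorem exists_isBlock_mem {e : α} (he : e ∈ M.E) : ∃ B, IsBlock M B ∧ e ∈ B :=
  ⟨_, ⟨e, he, rfl⟩, he, .inl rfl⟩

theorem exists_isBlock_superset_of_isCircuit {C : Set α} (hC : M.IsCircuit C) :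
    ∃ B, IsBlock M B ∧ C ⊆ B := by
  obtain ⟨e, he⟩ := hC.nonempty
  exact ⟨_, ⟨e, hC.subset_ground he, rfl⟩, fun f hf => ⟨hC.subset_ground hf, .inr ⟨C, hC, he, hf⟩⟩⟩

theorem indep_of_forall_isBlock {I : Set α} (hI : I ⊆ M.E)
    (h : ∀ B, IsBlock M B → M.Indep (I ∩ B)) : M.Indep I := by
  by_contra hdep
  obtain ⟨C, hCI, hC⟩ := ((Matroid.not_indep_iff hI).1 hdep).exists_isCircuit_subset
  obtain ⟨B, hB, hCB⟩ := exists_isBlock_superset_of_isCircuit hC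
  exact hC.not_indep ((h B hB).subset (Set.subset_inter hCI hCB))

theorem isBasis_inter_of_isBlock {I B : Set α} (hI : M.IsBase I) (hB : IsBlock M B) :
    M.IsBasis (I ∩ B) B := by
  refine (hI.indep.subset Set.inter_subset_left).isBasis_of_forall_insert Set.inter_subset_right
    fun e he => ?_
  have heE := hB.subset_ground he.1
  rw [← Matroid.not_indep_iff
    (Set.insert_subset heE (Set.inter_subset_left.trans hI.subset_ground))]
  intro hind
  refine (hI.insert_dep ⟨heE, fun heI => he.2 ⟨heI, he.1⟩⟩).not_indep
    (indep_of_forall_isBlock (Set.insert_subset heE hI.subset_ground) fun A hA => ?_)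
  by_cases heA : e ∈ A
  · rwa [hA.eq_of_mem hB heA he.1, Set.insert_inter_of_mem he.1]
  · rw [Set.insert_inter_of_notMem heA]
    exact hI.indep.subset Set.inter_subset_left

theorem isBase_iff_forall_isBlock {I : Set α} (hI : I ⊆ M.E) :
    M.IsBase I ↔ ∀ B, IsBlock M B → (M.restrict B).IsBase (I ∩ B) := by
  refine ⟨fun h B hB => (isBasis_inter_of_isBlock h hB).isBase_restrict, fun h => ?_⟩
  have hbasis (B : Set α) (hB : IsBlock M B) : M.IsBasis (I ∩ B) B :=
    (Matroid.isBase_restrict_iff hB.subset_ground).1 (h B hB)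
  refine (indep_of_forall_isBlock hI fun B hB => (hbasis B hB).indep).isBase_of_forall_insert
    fun e he hind => ?_
  obtain ⟨B, hB, heB⟩ := exists_isBlock_mem he.1
  refine ((hbasis B hB).insert_dep ⟨heB, fun heI => he.2 heI.1⟩).not_indep (hind.subset ?_)
  exact Set.insert_subset_insert Set.inter_subset_left

end Blocks

section FacetIdeal

variable {k : Type*} [Field k] {α : Type*} {M : Matroid α}

/-- The monomials `x^σ` in `k[x_e : e ∈ E]`, `σ` a basis of the matroid `N` on a subset of `E`. -/
def facetMonomials (k : Type*) [Field k] (E : Set α) (N : Matroid α) : Set (MvPolynomial E k) :=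
  {f | ∃ σ : Finset E, N.IsBase ((↑) '' (σ : Set E)) ∧ f = ∏ e ∈ σ, X e}

theorem image_rename_facetMonomials {A E : Set α} (h : A ⊆ E) {N : Matroid α} (hN : N.E ⊆ A) :
    rename (Set.inclusion h) '' facetMonomials k A N = facetMonomials k E N := by
  classical
  ext f
  constructor
  · rintro ⟨_, ⟨σ, hσ, rfl⟩, rfl⟩
    refine ⟨σ.map ⟨_, Set.inclusion_injective h⟩, ?_, ?_⟩
    · rwa [Finset.coe_map, Set.image_image]
    · rw [Finset.prod_map, map_prod]
      exact Finset.prod_congr rfl fun e _ => rename_X _ e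
  · rintro ⟨σ, hσ, rfl⟩
    have hσA (e : E) (he : e ∈ σ) : (e : α) ∈ A := hN (hσ.subset_ground ⟨e, he, rfl⟩)
    obtain ⟨τ, rfl⟩ : ∃ τ : Finset A, τ.map ⟨_, Set.inclusion_injective h⟩ = σ :=
      ⟨σ.preimage _ (Set.inclusion_injective h).injOn, Finset.ext fun e => by
        simp only [Finset.mem_map, Finset.mem_preimage, Function.Embedding.coeFn_mk]
        exact ⟨fun ⟨_, ha, hae⟩ => hae ▸ ha, fun he => ⟨⟨e, hσA e he⟩, he, rfl⟩⟩⟩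
    refine ⟨_, ⟨τ, ?_, rfl⟩, ?_⟩
    · rwa [Finset.coe_map, Set.image_image] at hσ
    · rw [Finset.prod_map, map_prod]
      exact Finset.prod_congr rfl fun e _ => rename_X _ e

theorem blockIdeal_eq_span {B : Set α} (h : B ⊆ M.E) :
    blockIdeal k M h = Ideal.span (facetMonomials k M.E (M.restrict B)) := by
  rw [← image_rename_facetMonomials h M.restrict_ground_eq.subset]
  exact Ideal.map_span _ _

theorem isMonomialIdealIn_blockIdeal {B : Set α} (h : B ⊆ M.E) :
    IsMonomialIdealIn ((↑) ⁻¹' B) (blockIdeal k M h) := by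
  classical
  refine ⟨{m | ∃ σ : Finset M.E, (M.restrict B).IsBase ((↑) '' (σ : Set M.E)) ∧
    m = ∑ e ∈ σ, Finsupp.single e 1}, ?_, ?_⟩
  · rintro _ ⟨σ, hσ, rfl⟩ e he
    obtain ⟨f, hf, hef⟩ := Finset.mem_biUnion.1 (Finsupp.support_finsetSum he)
    obtain rfl := Finset.mem_singleton.1 (Finsupp.support_single_subset hef)
    exact hσ.subset_ground ⟨e, hf, rfl⟩
  · rw [blockIdeal_eq_span]
    congr 1
    ext f
    constructor
    · rintro ⟨σ, hσ, rfl⟩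
      exact ⟨_, ⟨σ, hσ, rfl⟩, monomial_sum_one σ _⟩
    · rintro ⟨_, ⟨σ, hσ, rfl⟩, rfl⟩
      exact ⟨σ, hσ, monomial_sum_one σ _⟩

theorem exists_index_of_isBlock {ι : Type*} {B : ι → Set α} (hB : ∀ j, IsBlock M (B j))
    (hinj : Function.Injective B) (hall : ∀ A, IsBlock M A → ∃ j, B j = A) :
    ∃ b : M.E → ι, ∀ (e : M.E) j, (e : α) ∈ B j ↔ b e = j := by
  have hmem (e : M.E) : ∃ j, (e : α) ∈ B j := by
    obtain ⟨A, hA, he⟩ := exists_isBlock_mem e.2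
    obtain ⟨j, rfl⟩ := hall A hA
    exact ⟨j, he⟩
  choose b hb using hmem
  refine ⟨b, fun e j => ⟨fun he => hinj ((hB _).eq_of_mem (hB j) (hb e) he), ?_⟩⟩
  rintro rfl
  exact hb e

open scoped Pointwise in
theorem facetMonomials_eq_prod {ι : Type*} [Fintype ι] {B : ι → Set α}
    (hB : ∀ j, IsBlock M (B j)) (hinj : Function.Injective B)
    (hall : ∀ A, IsBlock M A → ∃ j, B j = A) :
    facetMonomials k M.E M = ∏ j, facetMonomials k M.E (M.restrict (B j)) := by
  classical
  obtain ⟨b, hb⟩ := exists_index_of_isBlock hB hinj hall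
  have isBase_iff (σ : Finset M.E) : M.IsBase ((↑) '' (σ : Set M.E)) ↔
      ∀ j, (M.restrict (B j)).IsBase ((↑) '' ({e ∈ σ | b e = j} : Set M.E)) := by
    rw [isBase_iff_forall_isBlock (Subtype.coe_image_subset _ _)]
    have inter_eq (j : ι) :
        ((↑) '' (σ : Set M.E) ∩ B j : Set α) = (↑) '' ({e ∈ σ | b e = j} : Set M.E) := by
      rw [← Set.image_inter_preimage]
      exact congrArg _ (Set.ext fun e => and_congr_right fun _ => hb e j)
    simp only [← inter_eq]
    refine ⟨fun h j => h _ (hB j), fun h A hA => ?_⟩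
    obtain ⟨j, rfl⟩ := hall A hA
    exact h j
  ext f
  simp only [Set.mem_fintype_prod]
  constructor
  · rintro ⟨σ, hσ, rfl⟩
    refine ⟨fun j => ∏ e ∈ σ with b e = j, X e, fun j => ⟨_, ?_, rfl⟩,
      Finset.prod_fiberwise σ b _⟩
    simpa only [Finset.coe_filter] using (isBase_iff σ).1 hσ j
  · rintro ⟨g, hg, rfl⟩
    choose σ hσ hgσ using fun j => hg (i := j)
    have hσb (j : ι) : {e ∈ Finset.univ.biUnion σ | b e = j} = σ j := by
      ext e
      simp only [Finset.mem_filter, Finset.mem_biUnion, Finset.mem_univ, true_and]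
      have index_eq {i : ι} (he : e ∈ σ i) : b e = i :=
        (hb e i).1 ((hσ i).subset_ground ⟨e, he, rfl⟩)
      refine ⟨?_, fun he => ⟨⟨j, he⟩, index_eq he⟩⟩
      rintro ⟨⟨i, he⟩, rfl⟩
      rwa [index_eq he]
    refine ⟨Finset.univ.biUnion σ, (isBase_iff _).2 fun j => ?_, ?_⟩
    · rw [← Finset.coe_filter, hσb]
      exact hσ j
    · rw [← Finset.prod_fiberwise _ b]
      simp only [hσb, hgσ]

open scoped Pointwise in
theorem facetIdeal_eq_prod {ι : Type*} [Fintype ι] {B : ι → Set α}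
    (hB : ∀ j, IsBlock M (B j)) (hinj : Function.Injective B)
    (hall : ∀ A, IsBlock M A → ∃ j, B j = A) :
    facetIdeal k M = ∏ j, blockIdeal k M (hB j).subset_ground := by
  simp only [blockIdeal_eq_span]
  rw [Ideal.prod_span, ← facetMonomials_eq_prod hB hinj hall]
  rfl

end FacetIdeal

section Family

section Boundary

variable {S : Type*} [CommRing S] {t : ℕ}

open Classical in
/-- The boundary of the tensor product of a finite family of complexes, with the Koszul sign
`(-1) ^ (deg y₁ + ⋯ + deg yⱼ₋₁)` in front of the boundary of the `j`-th factor. -/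
noncomputable def totalMat {X : Fin t → Type*} (deg : ∀ j, X j → ℕ)
    (D : ∀ j, Matrix (X j) (X j) S) : Matrix (∀ j, X j) (∀ j, X j) S :=
  fun x y => ∑ j, if ∀ a, a ≠ j → x a = y a then
    (-1) ^ (∑ a with a < j, deg a (y a)) * D j (x j) (y j) else 0

theorem totalMat_cons {X : Fin (t + 1) → Type*} [DecidableEq (X 0)]
    [DecidableEq (∀ j : Fin t, X j.succ)] (deg : ∀ j, X j → ℕ) (D : ∀ j, Matrix (X j) (X j) S) :
    (totalMat deg D).submatrix (Fin.consEquiv X) (Fin.consEquiv X) =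
      tensorMat (deg 0) (D 0) (totalMat (fun j => deg j.succ) fun j => D j.succ) := by
  classical
  ext ⟨x, x'⟩ ⟨y, y'⟩
  have eq_off_zero : (∀ a, a ≠ 0 → (Fin.cons x x' : ∀ j, X j) a = (Fin.cons y y' : ∀ j, X j) a) ↔
      x' = y' := by
    simp [Fin.forall_fin_succ, funext_iff]
  have eq_off_succ (j : Fin t) : (∀ a, a ≠ j.succ → (Fin.cons x x' : ∀ j, X j) a =
      (Fin.cons y y' : ∀ j, X j) a) ↔ x = y ∧ ∀ a, a ≠ j → x' a = y' a := by
    simp [Fin.forall_fin_succ, (Fin.succ_ne_zero j).symm]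
  have sum_lt_succ (j : Fin t) : ∑ a with a < j.succ, deg a ((Fin.cons y y' : ∀ j, X j) a) =
      deg 0 y + ∑ a with a < j, deg a.succ (y' a) := by
    simp [Finset.sum_filter, Fin.sum_univ_succ]
  simp only [submatrix_apply, totalMat, tensorMat, Fin.consEquiv, Equiv.coe_fn_mk,
    Fin.sum_univ_succ, Fin.cons_zero, Fin.cons_succ]
  congr 1
  · simp only [eq_off_zero]
    simp [one_apply]
  · simp only [eq_off_succ, sum_lt_succ]
    by_cases hxy : x = y
    · simp [hxy, pow_add, mul_assoc, Finset.mul_sum, signMat, totalMat]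
    · simp [hxy, signMat]

theorem totalMat_mem {X : Fin t → Type*} {deg : ∀ j, X j → ℕ} {D : ∀ j, Matrix (X j) (X j) S}
    {x y : ∀ j, X j} {A : AddSubgroup S}
    (h : ∀ j, (∀ a, a ≠ j → x a = y a) → D j (x j) (y j) ∈ A) : totalMat deg D x y ∈ A := by
  refine sum_mem fun j _ => ?_
  split_ifs with hxy
  · rcases neg_one_pow_eq_or S (∑ a with a < j, deg a (y a)) with hs | hs
    · rw [hs, one_mul]
      exact h j hxy
    · rw [hs, neg_one_mul]
      exact A.neg_mem (h j hxy)
  · exact A.zero_mem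

theorem add_sum_eq_sum {ι : Type*} [Fintype ι] {f g : ι → ℕ} {j : ι} {p : ℕ}
    (h : ∀ a, a ≠ j → f a = g a) (hj : p + f j = g j) : p + ∑ a, f a = ∑ a, g a := by
  classical
  rw [Fintype.sum_eq_add_sum_compl j f, Fintype.sum_eq_add_sum_compl j g, ← hj, add_assoc]
  congr 2
  exact Finset.sum_congr rfl fun a ha => h a (by simpa using ha)

theorem totalMat_eq_zero {X : Fin t → Type*} {deg : ∀ j, X j → ℕ}
    {D : ∀ j, Matrix (X j) (X j) S} (hD : ∀ j x y, D j x y ≠ 0 → deg j y = deg j x + 1)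
    {x y : ∀ j, X j} (hxy : ∑ j, deg j (y j) ≠ ∑ j, deg j (x j) + 1) : totalMat deg D x y = 0 := by
  refine totalMat_mem (A := ⊥) fun j hj => by_contra fun h0 => hxy ?_
  rw [← add_sum_eq_sum (fun a ha => congrArg (deg a) (hj a ha))
    ((add_comm _ _).trans (hD j _ _ h0).symm), add_comm]

theorem span_range_prod {ι : Type*} [Fintype ι] {X : ι → Type*} (ε : ∀ j, X j → S) :
    Ideal.span (Set.range fun x : ∀ j, X j => ∏ j, ε j (x j)) =
      ∏ j, Ideal.span (Set.range (ε j)) := by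
  rw [Ideal.prod_span]
  congr 1
  ext f
  rw [Set.mem_fintype_prod]
  constructor
  · rintro ⟨x, rfl⟩
    exact ⟨_, fun j => ⟨x j, rfl⟩, rfl⟩
  · rintro ⟨g, hg, rfl⟩
    choose x hx using hg
    exact ⟨x, Finset.prod_congr rfl fun j _ => hx j⟩

end Boundary

theorem isFreeResolution_totalMat {σ k : Type*} [CommRing k] {t : ℕ} {X : Fin t → Type*}
    [∀ j, Fintype (X j)] {deg : ∀ j, X j → ℕ} {D : ∀ j, Matrix (X j) (X j) (MvPolynomial σ k)}
    {ε : ∀ j, X j → MvPolynomial σ k} (h : ∀ j, IsFreeResolution (deg j) (D j) (ε j))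
    {V : Fin t → Set σ} (hV : Pairwise (Function.onFun Disjoint V))
    (hε : ∀ j, IsMonomialIdealIn (V j) (Ideal.span (Set.range (ε j)))) :
    IsFreeResolution (fun x : ∀ j, X j => ∑ j, deg j (x j)) (totalMat deg D)
      (fun x => ∏ j, ε j (x j)) := by
  classical
  induction t with
  | zero =>
    have totalMat_eq : totalMat deg D = 0 := by
      ext x y
      rw [totalMat, Finset.univ_eq_empty, Finset.sum_empty, Matrix.zero_apply]
    refine ⟨?_, ?_, ?_, ?_, fun v hv => ⟨0, ?_⟩⟩
    · simp [totalMat_eq]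
    · simp
    · simp [totalMat_eq]
    · simp [totalMat_eq]
    · have hv0 : v default = 0 := by simpa [dotProduct] using hv.2
      rw [mulVec_zero]
      exact funext fun x => (congrArg v (Subsingleton.elim x default)).trans hv0 |>.symm
  | succ t ih =>
    have tail := ih (fun j => h j.succ) (fun i j hij => hV ((Fin.succ_injective t).ne hij))
      fun j => hε j.succ
    have hdisj : Disjoint (V 0) (⋃ j ∈ (Finset.univ : Finset (Fin t)), V j.succ) := by
      simp only [Set.disjoint_iUnion_right]
      exact fun j _ => hV (Fin.succ_ne_zero j).symm
    have htail : IsMonomialIdealIn (⋃ j ∈ (Finset.univ : Finset (Fin t)), V j.succ)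
        (Ideal.span (Set.range fun x : ∀ j : Fin t, X j.succ => ∏ j, ε j.succ (x j))) := by
      rw [span_range_prod]
      exact .prod fun j _ => hε j.succ
    have hcons := (h 0).tensor_of_disjoint tail hdisj (hε 0) htail
    rw [← totalMat_cons] at hcons
    convert hcons.submatrix (Fin.consEquiv X).symm using 1
    · ext x
      simp [Fin.sum_univ_succ, Fin.consEquiv, Fin.tail]
    · simp
    · ext x
      simp [Fin.prod_univ_succ, Fin.consEquiv, Fin.tail, vec, vecMulVec_apply, mul_comm]

end Family

section Graded

variable {σ k : Type*} [Field k]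

/-- The homogeneous elements of degree `m` of `S(-p)`. -/
noncomputable def twistedPart (σ k : Type*) [Field k] (p m : ℕ) : Submodule k (MvPolynomial σ k) :=
  restrictSupport k {s | s.degree + p = m}

theorem mul_mem_twistedPart {p q m : ℕ} {f g : MvPolynomial σ k} (hf : f ∈ twistedPart σ k p q)
    (hg : g ∈ twistedPart σ k q m) : f * g ∈ twistedPart σ k p m := by
  classical
  intro s hs
  obtain ⟨s₁, h₁, s₂, h₂, rfl⟩ := Finset.mem_add.1 (support_mul f g hs)
  have h₁ : s₁.degree + p = q := hf h₁
  have h₂ : s₂.degree + q = m := hg h₂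
  change (s₁ + s₂).degree + p = m
  rw [map_add]
  omega

theorem one_mem_twistedPart (p : ℕ) : (1 : MvPolynomial σ k) ∈ twistedPart σ k p p := by
  rw [← C_1, C_apply, twistedPart, monomial_mem_restrictSupport]
  exact .inl (by simp)

theorem mem_twistedPart_zero_iff {f : MvPolynomial σ k} {m : ℕ} :
    f ∈ twistedPart σ k 0 m ↔ f.IsHomogeneous m := by
  rw [← mem_homogeneousSubmodule, homogeneousSubmodule_eq_finsupp_supported]
  rfl

theorem isHomogeneousVec_iff {ι : Type} {deg : ι → ℕ} {m : ℕ} {v : ι → MvPolynomial σ k} :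
    IsHomogeneousVec deg m v ↔ ∀ b, v b ∈ twistedPart σ k (deg b) m :=
  Iff.rfl

theorem isHomogeneousVec_single {ι : Type} [DecidableEq ι] (deg : ι → ℕ) (b : ι) :
    IsHomogeneousVec deg (deg b) (Pi.single b (1 : MvPolynomial σ k)) := by
  refine isHomogeneousVec_iff.2 fun c => ?_
  by_cases h : c = b
  · subst h
    rw [Pi.single_eq_same]
    exact one_mem_twistedPart _
  · rw [Pi.single_eq_of_ne h]
    exact zero_mem _

theorem forall_isHomogeneousVec_mulVec_iff {ι κ : Type} [Fintype κ] {deg : ι → ℕ} {deg' : κ → ℕ}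
    {A : Matrix ι κ (MvPolynomial σ k)} :
    (∀ m v, IsHomogeneousVec deg' m v → IsHomogeneousVec deg m (A *ᵥ v)) ↔
      ∀ b c, A b c ∈ twistedPart σ k (deg b) (deg' c) := by
  classical
  refine ⟨fun h b c => ?_, fun h m v hv b => ?_⟩
  · have := h _ _ (isHomogeneousVec_single deg' c) b
    rwa [mulVec_single_one] at this
  · exact (twistedPart σ k (deg b) m).sum_mem fun c _ => mul_mem_twistedPart (h b c) (hv c)

theorem forall_isHomogeneous_apply_iff {κ : Type} [Finite κ] [DecidableEq κ] {deg : κ → ℕ}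
    {ε : (κ → MvPolynomial σ k) →ₗ[MvPolynomial σ k] MvPolynomial σ k} :
    (∀ m v, IsHomogeneousVec deg m v → (ε v).IsHomogeneous m) ↔
      ∀ b, (ε (Pi.single b 1)).IsHomogeneous (deg b) := by
  cases nonempty_fintype κ
  refine ⟨fun h b => h _ _ (isHomogeneousVec_single deg b), fun h m v hv => ?_⟩
  rw [pi_eq_sum_univ' v, map_sum, ← mem_twistedPart_zero_iff]
  refine sum_mem fun b _ => ?_
  rw [map_smul, smul_eq_mul, mul_comm]
  exact mul_mem_twistedPart (mem_twistedPart_zero_iff.2 (h b)) (isHomogeneousVec_iff.1 hv b)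

theorem range_mulVecLin_le_smul_top_iff {R ι κ : Type*} [CommRing R] [Finite ι] [Fintype κ]
    {J : Ideal R} {A : Matrix ι κ R} :
    LinearMap.range A.mulVecLin ≤ J • (⊤ : Submodule R (ι → R)) ↔ ∀ b c, A b c ∈ J := by
  classical
  simp only [LinearMap.range_le_iff_comap, Submodule.eq_top_iff', Submodule.mem_comap,
    mulVecLin_apply, mem_smul_top_pi_iff, smul_eq_mul, Ideal.mul_top]
  refine ⟨fun h b c => ?_, fun h v b => sum_mem fun c _ => J.mul_mem_right _ (h b c)⟩
  have := h (Pi.single c 1) b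
  rwa [mulVec_single_one] at this

theorem forall_single_mem_iff {R ι : Type*} {M : ι → Type*} [Semiring R] [DecidableEq ι]
    [∀ i, AddCommMonoid (M i)] [∀ i, Module R (M i)] {p : ∀ i, Submodule R (M i)} {i : ι}
    {w : M i} : (∀ j, Pi.single i w j ∈ p j) ↔ w ∈ p i := by
  refine ⟨fun h => by simpa only [Pi.single_eq_same] using h i, fun h j => ?_⟩
  obtain rfl | hj := eq_or_ne j i
  · rwa [Pi.single_eq_same]
  · rw [Pi.single_eq_of_ne hj]
    exact zero_mem _

namespace GradedFreeSeq

variable {G : GradedFreeSeq σ k}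

/-- The boundary map of `⨁_u F_u`. -/
noncomputable def boundary (G : GradedFreeSeq σ k) :
    Matrix (Σ u, G.gens u) (Σ u, G.gens u) (MvPolynomial σ k) :=
  .of G.entry

theorem boundary_succ (u : ℕ) (b : G.gens u) (c : G.gens (u + 1)) :
    G.boundary ⟨u, b⟩ ⟨u + 1, c⟩ = G.mat u b c :=
  dif_pos rfl

theorem boundary_eq_zero {x y : Σ u, G.gens u} (h : y.1 ≠ x.1 + 1) : G.boundary x y = 0 :=
  dif_neg h

theorem forall_boundary_mem_iff {A : (Σ u, G.gens u) → (Σ u, G.gens u) →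
    AddSubgroup (MvPolynomial σ k)} :
    (∀ x y, G.boundary x y ∈ A x y) ↔ ∀ u b c, G.mat u b c ∈ A ⟨u, b⟩ ⟨u + 1, c⟩ := by
  refine ⟨fun h u b c => boundary_succ u b c ▸ h _ _, fun h x y => ?_⟩
  by_cases hxy : y.1 = x.1 + 1
  · obtain ⟨u, b⟩ := x
    obtain ⟨_, c⟩ := y
    obtain rfl := hxy
    rw [boundary_succ]
    exact h u b c
  · rw [boundary_eq_zero hxy]
    exact zero_mem _

/-- The augmentation `ε : F_0 → S`, extended by zero to a row vector on `⨁_u F_u`. -/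
noncomputable def augVec [DecidableEq (G.gens 0)]
    (ε : (G.gens 0 → MvPolynomial σ k) →ₗ[MvPolynomial σ k] MvPolynomial σ k) :
    (Σ u, G.gens u) → MvPolynomial σ k
  | ⟨0, b⟩ => ε (Pi.single b 1)
  | ⟨_ + 1, _⟩ => 0

/-- The kernel of the map `F_u → F_{u-1}`, where `F_{-1} = S` and `F_0 → F_{-1}` is `ε`. -/
noncomputable def kernel (G : GradedFreeSeq σ k)
    (ε : (G.gens 0 → MvPolynomial σ k) →ₗ[MvPolynomial σ k] MvPolynomial σ k) :
    ∀ u, Submodule (MvPolynomial σ k) (G.gens u → MvPolynomial σ k)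
  | 0 => LinearMap.ker ε
  | u + 1 => LinearMap.ker (G.d u)

theorem exists_augVec_eq [DecidableEq (G.gens 0)] {e : (Σ u, G.gens u) → MvPolynomial σ k}
    (he : ∀ x, e x ≠ 0 → x.1 = 0) : ∃ ε, augVec ε = e := by
  refine ⟨Fintype.linearCombination (MvPolynomial σ k) fun b => e ⟨0, b⟩, funext ?_⟩
  rintro ⟨_ | u, b⟩
  · rw [augVec, Fintype.linearCombination_apply_single, one_smul]
  · exact (by_contra fun h => absurd (he ⟨u + 1, b⟩ fun h0 => h h0.symm) u.succ_ne_zero)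

theorem span_range_augVec [DecidableEq (G.gens 0)]
    (ε : (G.gens 0 → MvPolynomial σ k) →ₗ[MvPolynomial σ k] MvPolynomial σ k) :
    Ideal.span (Set.range (augVec ε)) = LinearMap.range ε := by
  refine le_antisymm (Ideal.span_le.2 ?_) ?_
  · rintro _ ⟨⟨_ | u, b⟩, rfl⟩
    exacts [⟨_, rfl⟩, zero_mem _]
  · rintro _ ⟨v, rfl⟩
    rw [pi_eq_sum_univ' v, map_sum]
    refine sum_mem fun b _ => ?_
    rw [map_smul]
    exact Ideal.mul_mem_left _ _ (Ideal.subset_span ⟨⟨0, b⟩, rfl⟩)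

section Minimal

variable [Fintype (Σ u, G.gens u)]

theorem boundary_mulVec_comp_mk (v : (Σ u, G.gens u) → MvPolynomial σ k) (u : ℕ) :
    (G.boundary *ᵥ v) ∘ Sigma.mk u = G.d u (v ∘ Sigma.mk (u + 1)) := by
  ext1 b
  refine (Fintype.sum_of_injective (Sigma.mk (u + 1)) sigma_mk_injective _ _ (fun x hx => ?_)
    fun c => ?_).symm
  · have : x.1 ≠ u + 1 := fun h => hx (by obtain ⟨_, c⟩ := x; obtain rfl := h; exact ⟨c, rfl⟩)
    exact mul_eq_zero_of_left (boundary_eq_zero this) _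
  · change _ = G.boundary ⟨u, b⟩ ⟨u + 1, c⟩ * _
    rw [boundary_succ]
    rfl

theorem exists_boundary_mulVec_eq_iff {v : (Σ u, G.gens u) → MvPolynomial σ k} :
    (∃ w, G.boundary *ᵥ w = v) ↔ ∀ u, v ∘ Sigma.mk u ∈ LinearMap.range (G.d u) := by
  constructor
  · rintro ⟨w, rfl⟩ u
    exact ⟨_, (boundary_mulVec_comp_mk w u).symm⟩
  · intro h
    choose w hw using h
    obtain ⟨W, hW⟩ : ∃ W : (Σ u, G.gens u) → MvPolynomial σ k,
        ∀ u, W ∘ Sigma.mk (u + 1) = w u :=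
      ⟨fun x => Nat.casesOn (motive := fun u => G.gens u → MvPolynomial σ k) x.1 0 w x.2,
        fun _ => rfl⟩
    refine ⟨W, funext fun x => ?_⟩
    have := boundary_mulVec_comp_mk W x.1
    rw [hW, hw] at this
    exact congrFun this x.2

section Augmentation

variable [DecidableEq (G.gens 0)]
  {ε : (G.gens 0 → MvPolynomial σ k) →ₗ[MvPolynomial σ k] MvPolynomial σ k}

theorem augVec_dotProduct (v : (Σ u, G.gens u) → MvPolynomial σ k) :
    augVec ε ⬝ᵥ v = ε (v ∘ Sigma.mk 0) := by
  rw [pi_eq_sum_univ' (v ∘ Sigma.mk 0), map_sum]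
  refine (Fintype.sum_of_injective (Sigma.mk 0) sigma_mk_injective _ _ ?_ fun b => ?_).symm
  · rintro ⟨_ | u, b⟩ hx
    · exact absurd ⟨b, rfl⟩ hx
    · exact zero_mul _
  · rw [map_smul, smul_eq_mul, mul_comm]
    rfl

theorem mem_cycles_boundary_iff {v : (Σ u, G.gens u) → MvPolynomial σ k} :
    v ∈ cycles G.boundary (augVec ε) ↔ ∀ u, v ∘ Sigma.mk u ∈ G.kernel ε u := by
  have boundary_mulVec_eq_zero : G.boundary *ᵥ v = 0 ↔ ∀ u, (G.boundary *ᵥ v) ∘ Sigma.mk u = 0 :=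
    ⟨fun h u => by rw [h]; rfl, fun h => funext fun x => congrFun (h x.1) x.2⟩
  rw [← Nat.and_forall_add_one, mem_cycles, and_comm, augVec_dotProduct, boundary_mulVec_eq_zero]
  simp only [boundary_mulVec_comp_mk, kernel, LinearMap.mem_ker]

theorem isFreeResolution_boundary_iff :
    IsFreeResolution Sigma.fst G.boundary (augVec ε) ↔
      ∀ u, LinearMap.range (G.d u) = G.kernel ε u := by
  rw [isFreeResolution_iff]
  constructor
  · rintro ⟨-, -, h⟩ u
    ext w
    obtain ⟨v, hv⟩ : ∃ v : (Σ u, G.gens u) → MvPolynomial σ k,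
        ∀ u', v ∘ Sigma.mk u' = Pi.single (M := fun u => G.gens u → MvPolynomial σ k) u w u' :=
      ⟨fun x => Pi.single (M := fun u => G.gens u → MvPolynomial σ k) u w x.1 x.2, fun _ => rfl⟩
    have hw := h v
    rw [mem_cycles_boundary_iff, exists_boundary_mulVec_eq_iff] at hw
    simp only [hv, forall_single_mem_iff] at hw
    exact hw.symm
  · intro h
    refine ⟨fun x y hxy => by_contra fun h0 => hxy (boundary_eq_zero h0), ?_, fun v => ?_⟩
    · rintro ⟨_ | u, b⟩ hb
      · rfl
      · exact absurd rfl hb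
    · rw [mem_cycles_boundary_iff, exists_boundary_mulVec_eq_iff]
      simp only [h]

end Augmentation

theorem isMinimalGradedResolution_iff {I : Ideal (MvPolynomial σ k)} :
    G.IsMinimalGradedResolution I ↔
      (∀ x y, G.boundary x y ∈ twistedPart σ k (G.deg x.1 x.2) (G.deg y.1 y.2)) ∧
      (∀ x y, G.boundary x y ∈ Ideal.span (Set.range (X : σ → MvPolynomial σ k))) ∧
      ∃ e, IsFreeResolution Sigma.fst G.boundary e ∧ Ideal.span (Set.range e) = I ∧
        ∀ x, (e x).IsHomogeneous (G.deg x.1 x.2) := by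
  classical
  have hdeg : (∀ x y, G.boundary x y ∈ twistedPart σ k (G.deg x.1 x.2) (G.deg y.1 y.2)) ↔
      ∀ u m v, IsHomogeneousVec (G.deg (u + 1)) m v → IsHomogeneousVec (G.deg u) m (G.d u v) :=
    (forall_boundary_mem_iff (A := fun x y =>
      (twistedPart σ k (G.deg x.1 x.2) (G.deg y.1 y.2)).toAddSubgroup)).trans
      (forall_congr' fun _ => forall_isHomogeneousVec_mulVec_iff.symm)
  have hmin : (∀ x y, G.boundary x y ∈ Ideal.span (Set.range (X : σ → MvPolynomial σ k))) ↔
      ∀ u, LinearMap.range (G.d u) ≤ Ideal.span (Set.range (X : σ → MvPolynomial σ k)) • ⊤ :=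
    (forall_boundary_mem_iff (A := fun _ _ => (Ideal.span (Set.range X)).toAddSubgroup)).trans
      (forall_congr' fun _ => range_mulVecLin_le_smul_top_iff.symm)
  rw [hdeg, hmin]
  constructor
  · rintro ⟨h₁, h₂, hexact, ε, hε, rfl, hker⟩
    refine ⟨h₁, h₂, augVec ε, isFreeResolution_boundary_iff.2 ?_, span_range_augVec ε, ?_⟩
    · rintro (_ | u)
      exacts [hker.symm, hexact u]
    · rintro ⟨_ | u, b⟩
      exacts [forall_isHomogeneous_apply_iff.1 hε b, isHomogeneous_zero _ _ _]
  · rintro ⟨h₁, h₂, e, he, rfl, hhom⟩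
    obtain ⟨ε, rfl⟩ := exists_augVec_eq he.deg_eq_zero
    have hexact := isFreeResolution_boundary_iff.1 he
    exact ⟨h₁, h₂, fun u => hexact (u + 1), ε,
      forall_isHomogeneous_apply_iff.2 fun b => hhom ⟨0, b⟩, (span_range_augVec ε).symm,
      (hexact 0).symm⟩

end Minimal

section Tensor

variable {t : ℕ} {F : Fin t → GradedFreeSeq σ k}

/-- The basis of `⨁_i (F_1 ⊗ ⋯ ⊗ F_t)_i`, identified with the product of the bases of the
`⨁_u F_{j,u}`. -/
def tensorBasis (F : Fin t → GradedFreeSeq σ k) :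
    (Σ i, (tensor F).gens i) ≃ ∀ j, Σ u, (F j).gens u where
  toFun b j := ⟨b.2.1.1 j, b.2.2 j⟩
  invFun x := ⟨∑ j, (x j).1, ⟨fun j => (x j).1,
    Finset.mem_piAntidiag.2 ⟨rfl, fun _ _ => Finset.mem_univ _⟩⟩, fun j => (x j).2⟩
  left_inv := by
    rintro ⟨i, ⟨u, hu⟩, b⟩
    obtain rfl := (Finset.mem_piAntidiag.1 hu).1
    rfl
  right_inv _ := rfl

theorem sum_tensorBasis_fst (b : Σ i, (tensor F).gens i) : ∑ j, (tensorBasis F b j).1 = b.1 :=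
  (Finset.mem_piAntidiag.1 b.2.1.2).1

theorem boundary_tensor :
    (tensor F).boundary = (totalMat (fun _ x => x.1) fun j => (F j).boundary).submatrix
      (tensorBasis F) (tensorBasis F) := by
  refine Matrix.ext fun x y => ?_
  by_cases h : y.1 = x.1 + 1
  · obtain ⟨i, b⟩ := x
    obtain ⟨_, c⟩ := y
    obtain rfl := h
    rw [boundary_succ]
    simp only [GradedFreeSeq.tensor, submatrix_apply, totalMat]
    refine Finset.sum_congr rfl fun j _ => ?_
    congr
  · rw [boundary_eq_zero h, submatrix_apply, totalMat_eq_zero]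
    · exact fun j x y hxy => by_contra fun h0 => hxy (boundary_eq_zero h0)
    · simpa only [sum_tensorBasis_fst] using h

theorem IsMinimalGradedResolution.tensor {I : Fin t → Ideal (MvPolynomial σ k)}
    (h : ∀ j, (F j).IsMinimalGradedResolution (I j)) (hfin : ∀ j, Finite (Σ u, (F j).gens u))
    {V : Fin t → Set σ} (hV : Pairwise (Function.onFun Disjoint V))
    (hI : ∀ j, IsMonomialIdealIn (V j) (I j)) :
    (tensor F).IsMinimalGradedResolution (∏ j, I j) := by
  classical
  have := fun j => Fintype.ofFinite (Σ u, (F j).gens u)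
  have := Fintype.ofEquiv _ (tensorBasis F).symm
  choose hdeg hmin e he heI hedeg using fun j => isMinimalGradedResolution_iff.1 (h j)
  obtain rfl : (fun j => Ideal.span (Set.range (e j))) = I := funext heI
  rw [isMinimalGradedResolution_iff, boundary_tensor]
  refine ⟨fun x y => ?_, fun x y => ?_, fun b => ∏ j, e j (tensorBasis F b j), ?_, ?_, fun b => ?_⟩
  · refine totalMat_mem (A := (twistedPart σ k _ _).toAddSubgroup) fun j hj s hs => ?_
    exact add_sum_eq_sum (fun a ha => congrArg (fun z => (F a).deg z.1 z.2) (hj a ha))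
      (hdeg j _ _ hs)
  · exact totalMat_mem (A := (Ideal.span (Set.range (X : σ → MvPolynomial σ k))).toAddSubgroup)
      fun j _ => hmin j _ _
  · convert (isFreeResolution_totalMat he hV hI).submatrix (tensorBasis F) using 1
    · exact funext fun b => (sum_tensorBasis_fst b).symm
    · rfl
  · rw [← span_range_prod]
    exact congrArg _ ((tensorBasis F).surjective.range_comp fun x => ∏ j, e j (x j))
  · exact .prod _ _ _ fun j _ => hedeg j _

theorem HasLinearShape.finite_sigma {G : GradedFreeSeq σ k} {r l : ℕ} {n : ℕ → ℕ}
    (h : G.HasLinearShape r l n) : Finite (Σ u, G.gens u) := by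
  refine .of_surjective
    (fun x : Σ u : Fin (l + 1), G.gens u => (⟨x.1, x.2⟩ : Σ u, G.gens u)) ?_
  rintro ⟨u, b⟩
  obtain hu | hu := le_or_gt u l
  · exact ⟨⟨⟨u, Nat.lt_succ_of_le hu⟩, b⟩, rfl⟩
  · exact ((Fintype.card_eq_zero_iff.1 ((h.rank_eq u).trans (h.rank_zero u hu))).false b).elim

theorem HasLinearShape.tensor {r l : Fin t → ℕ} {n : Fin t → ℕ → ℕ}
    (h : ∀ j, (F j).HasLinearShape (r j) (l j) (n j)) :
    (tensor F).HasLinearShape (∑ j, r j) (∑ j, l j)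
      fun i => ∑ u ∈ Finset.piAntidiag (Finset.univ : Finset (Fin t)) i, ∏ j, n j (u j) where
  rank_eq i := by
    change Fintype.card ((u : ↥(Finset.piAntidiag (Finset.univ : Finset (Fin t)) i)) ×
      (∀ j, (F j).gens (u.1 j))) = _
    rw [Fintype.card_sigma]
    simp only [Fintype.card_pi, (h _).rank_eq]
    exact Finset.sum_coe_sort (Finset.piAntidiag (Finset.univ : Finset (Fin t)) i)
      fun u => ∏ j, n j (u j)
  deg_eq i b := by
    change ∑ j, (F j).deg (b.1.1 j) (b.2 j) = _
    simp only [(h _).deg_eq, Finset.sum_add_distrib]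
    rw [(Finset.mem_piAntidiag.1 b.1.2).1]
  rank_zero i hi := by
    refine Finset.sum_eq_zero fun u hu => ?_
    rw [← (Finset.mem_piAntidiag.1 hu).1] at hi
    obtain ⟨j, hj, hlt⟩ := Finset.exists_lt_of_sum_lt hi
    exact Finset.prod_eq_zero hj ((h j).rank_zero _ hlt)

end Tensor

end GradedFreeSeq
end Graded

theorem sum_piAntidiag_prod_ne_zero {ι : Type*} [Fintype ι] [DecidableEq ι] {n : ι → ℕ → ℕ}
    {l : ι → ℕ} (h : ∀ j, n j (l j) ≠ 0) :
    ∑ u ∈ Finset.piAntidiag Finset.univ (∑ j, l j), ∏ j, n j (u j) ≠ 0 := fun h0 =>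
  Finset.prod_ne_zero_iff.2 (fun j _ => h j) <| Finset.sum_eq_zero_iff.1 h0 l <|
    Finset.mem_piAntidiag.2 ⟨rfl, fun _ _ => Finset.mem_univ _⟩

end MatroidFacet

open MatroidFacet in
theorem theorem3p2_general {k : Type*} [Field k] {α : Type*} (M : Matroid α) {t : ℕ}
    (B : Fin t → Set α) (hB : ∀ j, IsBlock M (B j)) (hinj : Function.Injective B)
    (hall : ∀ X, IsBlock M X → ∃ j, B j = X) (F : Fin t → GradedFreeSeq M.E k)
    (hres : ∀ j, (F j).IsMinimalGradedResolution (blockIdeal k M (hB j).subset_ground))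
    (hfin : ∀ j, Finite (Σ u, (F j).gens u)) :
    (GradedFreeSeq.tensor F).IsMinimalGradedResolution (facetIdeal k M) := by
  rw [facetIdeal_eq_prod hB hinj hall]
  have hdisj : Pairwise (Function.onFun Disjoint fun j => ((↑) ⁻¹' B j : Set M.E)) :=
    fun i j hij => Set.disjoint_left.2 fun _ hi hj => hij (hinj ((hB i).eq_of_mem (hB j) hi hj))
  exact .tensor hres hfin hdisj fun j => isMonomialIdealIn_blockIdeal _

/-- Let `B_1, …, B_t` be the blocks of a finite matroid `M`, and let `F_j` be an `ℕ`-graded minimal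
free resolution of `S · F(B_j)` of the linear shape with ranks `n_{u,j}`, initial degree `r_j` and
last index `l_j`. Then the tensor product of the `F_j` is an `ℕ`-graded minimal free resolution of
`F(M)` of the linear shape with ranks `∑_{u_1 + ⋯ + u_t = i} ∏_j n_{u_j,j}`, initial degree `∑ r_j`
and last index `∑ l_j`; the last rank is nonzero if the last rank of every `F_j` is. -/
theorem theorem3p2 {k : Type*} [Field k] {α : Type*} (M : Matroid α) [M.Finite]
    {t : ℕ} (B : Fin t → Set α)
    (hB : ∀ j, MatroidFacet.IsBlock M (B j))
    (hinj : Function.Injective B)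
    (hall : ∀ X, MatroidFacet.IsBlock M X → ∃ j, B j = X)
    (r l : Fin t → ℕ) (n : Fin t → ℕ → ℕ)
    (F : Fin t → MatroidFacet.GradedFreeSeq M.E k)
    (hres : ∀ j, (F j).IsMinimalGradedResolution
      (MatroidFacet.blockIdeal k M (hB j).subset_ground))
    (hlin : ∀ j, (F j).HasLinearShape (r j) (l j) (n j))
    (β : ℕ → ℕ)
    (hβ : ∀ i, β i =
      ∑ u ∈ Finset.piAntidiag (Finset.univ : Finset (Fin t)) i, ∏ j, n j (u j)) :
    (MatroidFacet.GradedFreeSeq.tensor F).IsMinimalGradedResolution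
        (MatroidFacet.facetIdeal k M) ∧
      (MatroidFacet.GradedFreeSeq.tensor F).HasLinearShape (∑ j, r j) (∑ j, l j) β ∧
      ((∀ j, n j (l j) ≠ 0) → β (∑ j, l j) ≠ 0) := by
  obtain rfl := funext hβ
  exact ⟨theorem3p2_general M B hB hinj hall F hres fun j => (hlin j).finite_sigma,
    .tensor hlin, MatroidFacet.sum_piAntidiag_prod_ne_zero⟩
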